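/- Let $n\ge 2$ and $N\ge 1$ be integers and let $\rho:\mathrm{GL}_n(\mathbb{C})\to\mathrm{GL}(V)$ be a polynomial representation on a finite-dimensional complex vector space $V$. Let $\Gamma_0^n(N)$ be the group of all $g=\begin{pmatrix}A&B\\C&D\end{pmatrix}\in\mathrm{Sp}_{2n}(\mathbb{Z})$ ($n\times n$ blocks) with $C\equiv 0 \bmod N$, and let $\chi$ be a Dirichlet character modulo $N$. Let $S_\rho(\Gamma_0^n(N),\chi)$ be the space of holomorphic functions $F:\mathbb{H}_n\to V$ on the Siegel upper half-space $\mathbb{H}_n$ (the complex symmetric $n\times n$ matrices with positive definite imaginary part) such that $$\rho(CZ+D)^{-1}F\big((AZ+B)(CZ+D)^{-1}\big)=\chi(\det D)\,F(Z)\qquad\text{for all } g\in\Gamma_0^n(N),\ Z\in\mathbb{H}_n,$$ and such that in the Fourier expansion $F(Z)=\sum_T a_F(T)\,e^{2\pi i\,\mathrm{tr}(TZ)}$, in which $T$ runs over the half-integral matrices (the real symmetric $n\times n$ matrices with integral diagonal entries and all entries in $\tfrac12\mathbb{Z}$) and $a_F(T)\in V$, one has $T>0$ whenever $a_F(T)\neq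 0$. Let $F\in S_\rho(\Gamma_0^n(N),\chi)$ be nonzero, and assume that the conductor of $\chi$ is equal to $N$. Then there is a positive definite half-integral matrix $T$ that is primitive, i.e. whose content (the largest integer $c\ge 1$ such that $c^{-1}T$ is half-integral) is $1$, with $a_F(T)\neq 0$. -/

import Mathlib

open Matrix

noncomputable section

namespace Siegel

/-! ### Half-integral matrices, content -/

/-- A real `n × n` matrix is half-integral if it is symmetric, its diagonal entries are integers
and all its entries lie in `½ℤ`. -/
def IsHalfIntegral {n : ℕ} (T : Matrix (Fin n) (Fin n) ℝ) : Prop :=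
  T.IsSymm ∧ (∀ i, ∃ a : ℤ, T i i = a) ∧ ∀ i j, ∃ b : ℤ, 2 * T i j = b

/-- The set `Λ_n⁺` of half-integral, symmetric, positive definite matrices. -/
def halfIntegralPos (n : ℕ) : Set (Matrix (Fin n) (Fin n) ℝ) :=
  {T | IsHalfIntegral T ∧ T.PosDef}

/-- The content of `T`: the largest positive integer `c` such that `c⁻¹ • T` is half-integral.
(For a nonzero half-integral `T` the set below is nonempty and bounded.) -/
def content {n : ℕ} (T : Matrix (Fin n) (Fin n) ℝ) : ℕ :=
  sSup {c : ℕ | 0 < c ∧ IsHalfIntegral ((c : ℝ)⁻¹ • T)}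

/-- `T` is primitive if its content is `1`. -/
def IsPrimitive {n : ℕ} (T : Matrix (Fin n) (Fin n) ℝ) : Prop :=
  content T = 1

/-! ### The Siegel upper half-space and the action of the symplectic group -/

/-- The Siegel upper half-space: complex symmetric `n × n` matrices with positive definite
imaginary part. -/
def upperHalfSpace (n : ℕ) : Set (Matrix (Fin n) (Fin n) ℂ) :=
  {Z | Z.IsSymm ∧ (Z.map Complex.im).PosDef}

/-- The symplectic group `Sp_{2n}(ℤ)`, as a group of `2n × 2n` matrices in `n × n` blocks. -/
abbrev Sp (n : ℕ) : Type := Matrix.symplecticGroup (Fin n) ℤ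

variable {n : ℕ}

/-- The upper left block of `g`. -/
def blockA (g : Sp n) : Matrix (Fin n) (Fin n) ℤ := g.1.toBlocks₁₁
/-- The upper right block of `g`. -/
def blockB (g : Sp n) : Matrix (Fin n) (Fin n) ℤ := g.1.toBlocks₁₂
/-- The lower left block of `g`. -/
def blockC (g : Sp n) : Matrix (Fin n) (Fin n) ℤ := g.1.toBlocks₂₁
/-- The lower right block of `g`. -/
def blockD (g : Sp n) : Matrix (Fin n) (Fin n) ℤ := g.1.toBlocks₂₂

/-- `A Z + B` -/
def num (g : Sp n) (Z : Matrix (Fin n) (Fin n) ℂ) : Matrix (Fin n) (Fin n) ℂ :=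
  (blockA g).map (Int.cast : ℤ → ℂ) * Z + (blockB g).map (Int.cast : ℤ → ℂ)

/-- `C Z + D` -/
def denom (g : Sp n) (Z : Matrix (Fin n) (Fin n) ℂ) : Matrix (Fin n) (Fin n) ℂ :=
  (blockC g).map (Int.cast : ℤ → ℂ) * Z + (blockD g).map (Int.cast : ℤ → ℂ)

theorem block_relations (g : Sp n) :
    let A := (blockA g).map (Int.cast : ℤ → ℂ)
    let B := (blockB g).map (Int.cast : ℤ → ℂ)
    let C := (blockC g).map (Int.cast : ℤ → ℂ)
    let D := (blockD g).map (Int.cast : ℤ → ℂ)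
    Aᵀ * C = Cᵀ * A ∧ Bᵀ * D = Dᵀ * B ∧ Aᵀ * D - Cᵀ * B = 1 := by
  intro A B C D
  have h := SymplecticGroup.map_mem g.2 (Int.castRingHom ℂ)
  have e : g.1.map (Int.castRingHom ℂ) = fromBlocks A B C D := by
    conv_lhs => rw [← fromBlocks_toBlocks g.1]
    rw [fromBlocks_map]
    rfl
  rw [e] at h
  exact SymplecticGroup.fromBlocks_mem_iff.1 h

theorem num_transpose_mul_denom (g : Sp n) {Z : Matrix (Fin n) (Fin n) ℂ} (hZ : Z.IsSymm) :
    (num g Z)ᵀ * denom g Z = (denom g Z)ᵀ * num g Z := by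
  obtain ⟨h1, h2, h3⟩ := block_relations g
  have h3' := congrArg Matrix.transpose h3
  simp only [transpose_sub, transpose_mul, transpose_transpose, transpose_one] at h3'
  unfold num denom
  set A := (blockA g).map (Int.cast : ℤ → ℂ)
  set B := (blockB g).map (Int.cast : ℤ → ℂ)
  set C := (blockC g).map (Int.cast : ℤ → ℂ)
  set D := (blockD g).map (Int.cast : ℤ → ℂ)
  have key : (A * Z + B)ᵀ * (C * Z + D) - (C * Z + D)ᵀ * (A * Z + B)
      = Z * (Aᵀ * C - Cᵀ * A) * Z + (Bᵀ * D - Dᵀ * B) + Z * (Aᵀ * D - Cᵀ * B)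
        - (Dᵀ * A - Bᵀ * C) * Z := by
    simp only [transpose_add, transpose_mul, hZ.eq]
    noncomm_ring
  rw [h1, h2, h3, h3'] at key
  exact sub_eq_zero.1 (by rw [key]; simp)

theorem denom_conjTranspose_mul_num (g : Sp n) (Z : Matrix (Fin n) (Fin n) ℂ) :
    (denom g Z)ᴴ * num g Z - (num g Z)ᴴ * denom g Z = Z - Zᴴ := by
  obtain ⟨h1, h2, h3⟩ := block_relations g
  have h3' := congrArg Matrix.transpose h3
  simp only [transpose_sub, transpose_mul, transpose_transpose, transpose_one] at h3'
  unfold num denom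
  have hc : ∀ M : Matrix (Fin n) (Fin n) ℤ,
      (M.map (Int.cast : ℤ → ℂ))ᴴ = (M.map (Int.cast : ℤ → ℂ))ᵀ := by
    intro M; ext i j; simp
  have key : ∀ A B C D W : Matrix (Fin n) (Fin n) ℂ,
      (W * Cᵀ + Dᵀ) * (A * Z + B) - (W * Aᵀ + Bᵀ) * (C * Z + D)
      = W * (Cᵀ * A - Aᵀ * C) * Z + (Dᵀ * B - Bᵀ * D) + (Dᵀ * A - Bᵀ * C) * Z
        - W * (Aᵀ * D - Cᵀ * B) := by
    intro A B C D W
    noncomm_ring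
  rw [conjTranspose_add, conjTranspose_add, conjTranspose_mul, conjTranspose_mul,
    hc, hc, hc, hc, key, h1, h2, h3, h3']
  simp

theorem sub_conjTranspose_eq {Z : Matrix (Fin n) (Fin n) ℂ} (hZ : Z.IsSymm) :
    Z - Zᴴ = (2 * Complex.I) • (Z.map Complex.im).map ((↑) : ℝ → ℂ) := by
  ext i j
  have h : Z j i = Z i j := hZ.apply i j
  simp only [Matrix.sub_apply, conjTranspose_apply, Matrix.smul_apply, map_apply, h, smul_eq_mul]
  apply Complex.ext <;> simp
  ring

open scoped ComplexOrder in
theorem posDef_map_ofReal {Y : Matrix (Fin n) (Fin n) ℝ} :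
    (Y.map ((↑) : ℝ → ℂ)).PosDef ↔ Y.PosDef := by
  constructor
  · intro h
    refine PosDef.of_dotProduct_mulVec_pos ?_ ?_
    · ext i j
      have := congrFun (congrFun h.1 i) j
      simpa using this
    · intro x hx
      have h' := h.dotProduct_mulVec_pos (x := fun i => (x i : ℂ)) (by
        intro h0; apply hx; ext i; simpa using congrFun h0 i)
      have e : star (fun i => (x i : ℂ)) ⬝ᵥ (Y.map ((↑) : ℝ → ℂ)) *ᵥ (fun i => (x i : ℂ))
          = ((star x ⬝ᵥ Y *ᵥ x : ℝ) : ℂ) := by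
        simp [dotProduct, mulVec]
      rw [e] at h'
      exact_mod_cast h'
  · intro h
    refine PosDef.of_dotProduct_mulVec_pos ?_ ?_
    · ext i j
      have := congrFun (congrFun h.1 i) j
      simpa using this
    · intro v hv
      have hs : ∀ i j, Y i j = Y j i := fun i j => by
        have := congrFun (congrFun h.1 j) i
        simpa using this
      have e : star v ⬝ᵥ (Y.map ((↑) : ℝ → ℂ)) *ᵥ v
          = ((star (fun i => (v i).re) ⬝ᵥ Y *ᵥ (fun i => (v i).re)
            + star (fun i => (v i).im) ⬝ᵥ Y *ᵥ (fun i => (v i).im) : ℝ) : ℂ) := by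
        simp only [dotProduct, mulVec, Pi.star_apply, map_apply, star_trivial, Finset.mul_sum]
        apply Complex.ext
        · simp [← Finset.sum_add_distrib]
        · simp [Finset.sum_add_distrib]
          rw [Finset.sum_comm (s := Finset.univ) (t := Finset.univ)
            (f := fun i j => (v i).im * (Y i j * (v j).re)), ← sub_eq_add_neg, sub_eq_zero]
          refine Finset.sum_congr rfl fun i _ => Finset.sum_congr rfl fun j _ => ?_
          rw [hs j i]
          ring
      rw [e]
      have hnn : ∀ x, 0 ≤ star x ⬝ᵥ Y *ᵥ x := h.posSemidef.dotProduct_mulVec_nonneg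
      have : (fun i => (v i).re) ≠ 0 ∨ (fun i => (v i).im) ≠ 0 := by
        by_contra! hc
        apply hv
        ext i
        exact Complex.ext (congrFun hc.1 i) (congrFun hc.2 i)
      have hpos : 0 < star (fun i => (v i).re) ⬝ᵥ Y *ᵥ (fun i => (v i).re)
            + star (fun i => (v i).im) ⬝ᵥ Y *ᵥ (fun i => (v i).im) := by
        rcases this with h1 | h1
        · exact add_pos_of_pos_of_nonneg (h.dotProduct_mulVec_pos h1) (hnn _)
        · exact add_pos_of_nonneg_of_pos (hnn _) (h.dotProduct_mulVec_pos h1)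
      exact_mod_cast hpos

open scoped ComplexOrder in
theorem denom_det_ne_zero (g : Sp n) {Z : Matrix (Fin n) (Fin n) ℂ}
    (hZ : Z ∈ upperHalfSpace n) : (denom g Z).det ≠ 0 := by
  intro h0
  obtain ⟨v, hv, hv0⟩ := exists_mulVec_eq_zero_iff.2 h0
  have key := denom_conjTranspose_mul_num g Z
  rw [sub_conjTranspose_eq hZ.1] at key
  have hpos := (posDef_map_ofReal.2 hZ.2).dotProduct_mulVec_pos hv
  have k2 := congrArg (fun M => star v ⬝ᵥ M *ᵥ v) key
  have k3 : star v ᵥ* (denom g Z)ᴴ = 0 := by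
    rw [← star_mulVec, hv0, star_zero]
  simp only [sub_mulVec, smul_mulVec, dotProduct_smul, ← mulVec_mulVec, hv0,
    mulVec_zero, sub_zero] at k2
  rw [dotProduct_mulVec, k3, zero_dotProduct] at k2
  have : (2 * Complex.I) ≠ 0 := by simp
  rcases smul_eq_zero.1 k2.symm with h | h
  · exact this h
  · exact hpos.ne' h

/-- The automorphy factor `C Z + D` as an element of `GL_n(ℂ)`. -/
def denomGL (g : Sp n) (Z : upperHalfSpace n) : GL (Fin n) ℂ :=
  Matrix.GeneralLinearGroup.mkOfDetNeZero (denom g Z) (denom_det_ne_zero g Z.2)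

open scoped ComplexOrder in
theorem action_mem (g : Sp n) (Z : upperHalfSpace n) :
    num g Z * (denom g Z)⁻¹ ∈ upperHalfSpace n := by
  have hdet : IsUnit (denom g Z.1).det := (denom_det_ne_zero g Z.2).isUnit
  have h1 := num_transpose_mul_denom g Z.2.1
  have h2 := denom_conjTranspose_mul_num g Z.1
  rw [sub_conjTranspose_eq Z.2.1] at h2
  set P := num g Z.1
  set Q := denom g Z.1
  have hQ : Q * Q⁻¹ = 1 := mul_nonsing_inv _ hdet
  have hQt : (Q⁻¹)ᵀ * Qᵀ = 1 := by rw [← transpose_mul, hQ, transpose_one]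
  have hQh : (Q⁻¹)ᴴ * Qᴴ = 1 := by rw [← conjTranspose_mul, hQ, conjTranspose_one]
  have hs : (P * Q⁻¹).IsSymm := by
    unfold Matrix.IsSymm
    calc (P * Q⁻¹)ᵀ = (Q⁻¹)ᵀ * (Pᵀ * Q) * Q⁻¹ := by
          rw [transpose_mul, Matrix.mul_assoc, Matrix.mul_assoc, hQ, Matrix.mul_one]
      _ = P * Q⁻¹ := by
          rw [h1, ← Matrix.mul_assoc, hQt, Matrix.one_mul]
  refine ⟨hs, ?_⟩
  rw [← posDef_map_ofReal]
  have e : (2 * Complex.I) • ((P * Q⁻¹).map Complex.im).map ((↑) : ℝ → ℂ)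
      = (2 * Complex.I) • ((Q⁻¹)ᴴ * (Z.1.map Complex.im).map ((↑) : ℝ → ℂ) * Q⁻¹) := by
    rw [← sub_conjTranspose_eq hs, ← Matrix.smul_mul, ← Matrix.mul_smul, ← h2, Matrix.mul_sub,
      Matrix.sub_mul, ← Matrix.mul_assoc, hQh, Matrix.one_mul, conjTranspose_mul,
      ← Matrix.mul_assoc, Matrix.mul_assoc _ Q, hQ, Matrix.mul_one]
  rw [smul_right_injective _ (by simp : (2 * Complex.I) ≠ 0) e]
  refine (posDef_map_ofReal.2 Z.2.2).conjTranspose_mul_mul_same ?_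
  exact mulVec_injective_of_isUnit ((isUnit_nonsing_inv_iff).2 ((isUnit_iff_isUnit_det _).2 hdet))

/-- `g⟨Z⟩ = (A Z + B)(C Z + D)⁻¹` -/
def action (g : Sp n) (Z : upperHalfSpace n) : upperHalfSpace n :=
  ⟨num g Z * (denom g Z)⁻¹, action_mem g Z⟩

/-- The congruence subgroup `Γ_0^n(N)` of `Sp_{2n}(ℤ)`: the elements with `C ≡ 0 mod N`. -/
def Gamma0 (n N : ℕ) : Subgroup (Sp n) where
  carrier := {g | ∀ i j, (N : ℤ) ∣ blockC g i j}
  mul_mem' := by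
    intro g h hg hh i j
    have e : blockC (g * h) = blockC g * blockA h + blockD g * blockC h := by
      ext i j
      simp [blockA, blockC, blockD, toBlocks₁₁, toBlocks₂₁, toBlocks₂₂, Matrix.mul_apply]
    rw [e, Matrix.add_apply, Matrix.mul_apply, Matrix.mul_apply]
    exact dvd_add (Finset.dvd_sum fun k _ => (hg i k).mul_right _)
      (Finset.dvd_sum fun k _ => (hh k j).mul_left _)
  one_mem' := by
    intro i j
    simp [blockC, toBlocks₂₁]
  inv_mem' := by
    intro g hg i j
    have e : blockC g⁻¹ = -(blockC g)ᵀ := by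
      have hJ : (g⁻¹).1 = (-J (Fin n) ℤ) * g.1ᵀ * J (Fin n) ℤ := SymplecticGroup.coe_inv g
      unfold blockC
      rw [hJ]
      conv_lhs => rw [← fromBlocks_toBlocks g.1]
      simp [J, fromBlocks_transpose, fromBlocks_multiply, fromBlocks_neg]
    rw [e]
    simpa using hg j i

/-! ### Vector-valued Siegel modular forms -/

variable {V : Type*} [NormedAddCommGroup V] [NormedSpace ℂ V]

/-- A representation of `GL_n(ℂ)` on `V` is polynomial if its matrix coefficients are polynomials
in the entries of the matrix. -/
def IsPolynomialRep (ρ : Representation ℂ (GL (Fin n) ℂ) V) : Prop :=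
  ∀ (v : V) (l : Module.Dual ℂ V), ∃ P : MvPolynomial (Fin n × Fin n) ℂ,
    ∀ g : GL (Fin n) ℂ, l (ρ g v) = MvPolynomial.eval (fun p => g.1 p.1 p.2) P

/-- The slash operator `(F|_ρ g)(Z) = ρ(CZ+D)⁻¹ F(g⟨Z⟩)`. -/
def slash (ρ : Representation ℂ (GL (Fin n) ℂ) V) (F : upperHalfSpace n → V) (g : Sp n) :
    upperHalfSpace n → V :=
  fun Z => ρ (denomGL g Z)⁻¹ (F (action g Z))

/-- The symmetric matrix with entry `x {i,j}` at the places `(i,j)` and `(j,i)`: the linear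
coordinates on the space of symmetric matrices. -/
def symMat {R : Type*} (x : Sym2 (Fin n) → R) : Matrix (Fin n) (Fin n) R :=
  Matrix.of fun i j => x s(i, j)

open Classical in
/-- `F` is holomorphic on the Siegel upper half-space, viewed as an open subset of the complex
vector space of symmetric matrices. (Outside of that open set the function below is irrelevant.) -/
def IsHolomorphic (F : upperHalfSpace n → V) : Prop :=
  DifferentiableOn ℂ
    (fun z : Sym2 (Fin n) → ℂ =>
      if h : symMat z ∈ upperHalfSpace n then F ⟨symMat z, h⟩ else 0)
    {z | symMat z ∈ upperHalfSpace n}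

/-- The point `X + i·1` of the Siegel upper half-space, where `X` is the real symmetric matrix with
coordinates `x`. -/
def horoPoint (x : Sym2 (Fin n) → ℝ) : upperHalfSpace n :=
  ⟨(symMat x).map ((↑) : ℝ → ℂ) + Complex.I • (1 : Matrix (Fin n) (Fin n) ℂ), by
    refine ⟨?_, ?_⟩
    · ext i j
      simp [symMat, Sym2.eq_swap, Matrix.one_apply, eq_comm]
    · have e : ((symMat x).map ((↑) : ℝ → ℂ)
          + Complex.I • (1 : Matrix (Fin n) (Fin n) ℂ)).map Complex.im = 1 := by
        ext i j
        by_cases h : i = j <;> simp [Matrix.one_apply, h]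
      rw [e]
      exact PosDef.one⟩

/-- `q^T = exp(2πi tr(TZ))` -/
def qPow (T : Matrix (Fin n) (Fin n) ℝ) (Z : Matrix (Fin n) (Fin n) ℂ) : ℂ :=
  Complex.exp (2 * Real.pi * Complex.I * (T.map ((↑) : ℝ → ℂ) * Z).trace)

/-- The Fourier coefficient `a_F(T)` of a holomorphic `F` that is invariant under integral symmetric
translations: the integral of `F(Z) q^{-T}` over the real parts modulo `1`, at imaginary part `1`.
(By holomorphy, every other positive definite imaginary part gives the same value.) These are the
coefficients in `F(Z) = ∑_T a_F(T) q^T`. -/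
def fourierCoefficient (F : upperHalfSpace n → V) (T : Matrix (Fin n) (Fin n) ℝ) : V :=
  ∫ x : Sym2 (Fin n) → ℝ in {x | ∀ p, x p ∈ Set.Ioc (0 : ℝ) 1},
    (qPow T (horoPoint x).1)⁻¹ • F (horoPoint x)

/-- Siegel modular forms of genus `n`, automorphy factor `ρ`, level `N` and nebentypus `χ`. This is
the standard notion for `n ≥ 2`, the range in which it is used: no condition at the
cusps is needed then. (The case `det D ≡ 1 mod N` of the second condition contains the
invariance under `Γ_1^n(N)`.) -/
structure IsModularForm (N : ℕ) (ρ : Representation ℂ (GL (Fin n) ℂ) V)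
    (χ : DirichletCharacter ℂ N) (F : upperHalfSpace n → V) : Prop where
  holomorphic : IsHolomorphic F
  slash_eq : ∀ g ∈ Gamma0 n N, slash ρ F g = χ ((blockD g).det : ZMod N) • F

/-- Siegel cusp forms, the elements of `S_ρ(Γ_0^n(N), χ)`: modular forms such that
`a_F(T) ≠ 0` implies `T > 0`. -/
structure IsCuspForm (N : ℕ) (ρ : Representation ℂ (GL (Fin n) ℂ) V)
    (χ : DirichletCharacter ℂ N) (F : upperHalfSpace n → V) : Prop
    extends IsModularForm N ρ χ F where
  posDef_of_coeff_ne_zero :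
    ∀ T : Matrix (Fin n) (Fin n) ℝ, IsHalfIntegral T → fourierCoefficient F T ≠ 0 → T.PosDef

end Siegel

end

/-! A half-integral `T` with two coprime diagonal entries is primitive. Since `n ≥ 2`, distinct
indices `i`, `j` exist. Suppose all coefficients at primitive `T` vanish, fix `m > 0`, and let `φ`
be the Fourier-Jacobi coefficient of `F` of index `m`, the part of the expansion with `T j j = m`.
The group SL₂ embedded at `i` commutes with translations of `Z j j`, so `φ` is still equivariant
with character `χ` under the embedded Γ₀(N) (`slashSL2_fourierJacobi`). Its coefficients vanish
whenever `T i i` is prime to `m`.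

A one-variable oldform argument in `Z i i` now gives `φ = 0` (`IsCuspidalAt.eq_zero_of_coprime`).
Discarding the terms with `p ∣ T i i` turns level `K` into level `K p²` (`IsEquivariantAt.sieve`).
Sieving at all primes `p ∣ m` leaves nothing, and the sieves are undone one prime at a time: if `f`
has level `N M` with `p ∤ M` and its `p`-sieve is zero, then `f` is invariant under the translation
of `Z i i` by `1/p`, and this forces `f = 0` (`IsCuspidalAt.eq_zero_of_sieve_eq_zero`): - if `p ∣
N`, the translations and Γ₀(N M) generate enough elements to make `χ` trivial on the units congruent
to 1 modulo `N/p` unless `f = 0`, against the conductor being `N`; - if `p ∤ N`, they generate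
diag(p, 1/p), which shrinks translations by `p²`. So `f` is invariant under all `1/p^(2r)`, and
every `T i i` that occurs is divisible by all `p^(2r)`, impossible for `T i i > 0`.

A cusp form only has terms with `T j j > 0`, so the vanishing of all these `φ` gives `F = 0`. Only
uniqueness of the coefficients is needed, not convergence of the expansion: Fourier uniqueness on a
torus gives vanishing at all `X + i`, and the identity theorem along a complex line does the rest.
-/

noncomputable section

namespace Siegel

/-! ### Fourier coefficients of periodic functions -/

section Periodic

open MeasureTheory

variable {ι : Type*} [Fintype ι] {E : Type*} [NormedAddCommGroup E] [NormedSpace ℂ E]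

-- The normalisation with total mass one, for which integrals over the torus are integrals over the
-- unit cube.
local instance : MeasureSpace UnitAddCircle := ⟨AddCircle.haarAddCircle⟩

local instance : Measure.IsAddHaarMeasure (volume : Measure UnitAddCircle) :=
  inferInstanceAs (Measure.IsAddHaarMeasure AddCircle.haarAddCircle)

local instance : IsProbabilityMeasure (volume : Measure UnitAddCircle) :=
  inferInstanceAs (IsProbabilityMeasure AddCircle.haarAddCircle)

/-- The half-open unit cube. -/
def unitCube (ι : Type*) : Set (ι → ℝ) := {x | ∀ p, x p ∈ Set.Ioc (0 : ℝ) 1}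

/-- The character `exp (2πi ∑ kₚ xₚ)`. -/
def character (k : ι → ℤ) (x : ι → ℝ) : ℂ :=
  Complex.exp (2 * Real.pi * Complex.I * ∑ p, (k p : ℂ) * x p)

/-- The Fourier coefficients over the unit cube. -/
def cubeCoeff (φ : (ι → ℝ) → E) (k : ι → ℤ) : E :=
  ∫ x in unitCube ι, character (-k) x • φ x

/-- Invariance under integral translations. -/
def IsIntPeriodic (φ : (ι → ℝ) → E) : Prop :=
  ∀ (a : ι → ℤ) (x : ι → ℝ), φ (x + fun p => (a p : ℝ)) = φ x

theorem character_add (k : ι → ℤ) (x y : ι → ℝ) :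
    character k (x + y) = character k x * character k y := by
  simp only [character, ← Complex.exp_add, Pi.add_apply, Complex.ofReal_add, mul_add,
    Finset.sum_add_distrib]

theorem character_neg_mul (k : ι → ℤ) (x : ι → ℝ) : character (-k) x * character k x = 1 := by
  simp [character, ← Complex.exp_add]

@[fun_prop]
theorem continuous_character (k : ι → ℤ) : Continuous (character k) := by
  unfold character
  fun_prop

theorem mFourier_coe (k : ι → ℤ) (x : ι → ℝ) :
    UnitAddTorus.mFourier k (fun p => (x p : UnitAddCircle)) = character k x := by
  simp only [UnitAddTorus.mFourier, ContinuousMap.coe_mk, fourier_coe_apply, character,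
    ← Complex.exp_sum, Finset.mul_sum]
  congr 1
  refine Finset.sum_congr rfl fun p _ => ?_
  simp
  ring

omit [Fintype ι] in
theorem isOpenQuotientMap_torus :
    IsOpenQuotientMap (fun (x : ι → ℝ) (p : ι) => (x p : UnitAddCircle)) :=
  IsOpenQuotientMap.piMap fun _ => QuotientAddGroup.isOpenQuotientMap_mk

/-- The function on the torus with pull back `φ`, if `φ` is periodic. -/
def torusLift (φ : (ι → ℝ) → E) (t : UnitAddTorus ι) : E :=
  φ (fun p => (AddCircle.equivIoc (1 : ℝ) 0 (t p) : ℝ))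

omit [Fintype ι] [NormedAddCommGroup E] [NormedSpace ℂ E] in
theorem torusLift_coe {φ : (ι → ℝ) → E} (hφ : IsIntPeriodic φ) (x : ι → ℝ) :
    torusLift φ (fun p => (x p : UnitAddCircle)) = φ x := by
  have h : ∀ p, ∃ a : ℤ, (AddCircle.equivIoc (1 : ℝ) 0 (x p : UnitAddCircle) : ℝ) = x p + a := by
    intro p
    have h1 : ((AddCircle.equivIoc (1 : ℝ) 0 (x p : UnitAddCircle) : ℝ) : UnitAddCircle) = x p :=
      AddCircle.coe_equivIoc (p := (1 : ℝ)) (a := 0)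
    rw [← sub_eq_zero, ← AddCircle.coe_sub, AddCircle.coe_eq_zero_iff] at h1
    obtain ⟨a, ha⟩ := h1
    refine ⟨a, ?_⟩
    simp at ha
    linarith
  choose a ha using h
  rw [← hφ a x]
  unfold torusLift
  congr 1
  funext p
  exact ha p

omit [Fintype ι] [NormedSpace ℂ E] in
theorem continuous_torusLift {φ : (ι → ℝ) → E} (hφ : IsIntPeriodic φ) (hc : Continuous φ) :
    Continuous (torusLift φ) := by
  rw [isOpenQuotientMap_torus.isQuotientMap.continuous_iff]
  convert hc using 1
  funext x
  exact torusLift_coe hφ x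

theorem integral_unitCube {φ : (ι → ℝ) → E} (hφ : IsIntPeriodic φ) :
    ∫ x in unitCube ι, φ x = ∫ t, torusLift φ t := by
  rw [UnitAddTorus.integral_preimage _ 0]
  simp only [torusLift_coe hφ, Pi.zero_apply, zero_add, unitCube]

/-- On the torus this is invariance of Haar measure. -/
theorem integral_unitCube_translate {φ : (ι → ℝ) → E} (hφ : IsIntPeriodic φ) (y : ι → ℝ) :
    ∫ x in unitCube ι, φ (x + y) = ∫ x in unitCube ι, φ x := by
  have hφ' : IsIntPeriodic fun x => φ (x + y) := fun a x => by
    change φ (x + (fun p => (a p : ℝ)) + y) = φ (x + y)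
    rw [← hφ a (x + y), add_right_comm]
  rw [integral_unitCube hφ, integral_unitCube hφ',
    ← integral_add_right_eq_self (torusLift φ) (fun p => (y p : UnitAddCircle))]
  congr 1
  funext t
  obtain ⟨x, rfl⟩ := isOpenQuotientMap_torus.surjective t
  rw [torusLift_coe hφ', ← torusLift_coe hφ]
  rfl

theorem isIntPeriodic_character (k : ι → ℤ) : IsIntPeriodic (character k) := by
  intro a x
  rw [character_add]
  convert mul_one _
  rw [character, Complex.exp_eq_one_iff]
  refine ⟨∑ p, k p * a p, ?_⟩
  push_cast
  ring

theorem cubeCoeff_translate {φ : (ι → ℝ) → E} (hφ : IsIntPeriodic φ) (y : ι → ℝ) (k : ι → ℤ) :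
    cubeCoeff (fun x => φ (x + y)) k = character k y • cubeCoeff φ k := by
  have h : IsIntPeriodic fun x => character (-k) x • φ x := fun a x => by
    simp only [hφ a x, isIntPeriodic_character (-k) a x]
  unfold cubeCoeff
  rw [← integral_unitCube_translate h y, ← integral_smul]
  congr 1
  funext x
  rw [character_add, smul_smul, mul_comm (character (-k) x), ← mul_assoc,
    mul_comm (character k y), character_neg_mul, one_mul]

omit [Fintype ι] in
theorem unitCube_subset : unitCube ι ⊆ Set.Icc 0 1 :=
  fun _ hx => ⟨fun p => (hx p).1.le, fun p => (hx p).2⟩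

/-- Continuous functionals reduce to scalar functions on the torus. There the Fourier series is
zero, hence summable, hence converges pointwise to the function. -/
theorem eq_zero_of_cubeCoeff_eq_zero [CompleteSpace E] {φ : (ι → ℝ) → E} (hφ : IsIntPeriodic φ)
    (hc : Continuous φ) (h0 : ∀ k, cubeCoeff φ k = 0) : φ = 0 := by
  have key : ∀ k, UnitAddTorus.mFourierCoeff (torusLift φ) k = 0 := by
    intro k
    rw [← h0 k, UnitAddTorus.mFourierCoeff_eq_integral _ _ 0]
    simp only [torusLift_coe hφ, Pi.zero_apply, zero_add, mFourier_coe]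
    rfl
  have hcont := continuous_torusLift hφ hc
  have hz : torusLift φ = 0 := by
    funext t
    refine SeparatingDual.eq_zero_of_forall_dual_eq_zero (R := ℂ) fun l => ?_
    let g : C(UnitAddTorus ι, ℂ) := ⟨fun t => l (torusLift φ t), l.continuous.comp hcont⟩
    have hg : ∀ k, UnitAddTorus.mFourierCoeff g k = 0 := by
      intro k
      have e : UnitAddTorus.mFourierCoeff g k =
          l (UnitAddTorus.mFourierCoeff (torusLift φ) k) := by
        unfold UnitAddTorus.mFourierCoeff
        rw [← l.integral_comp_comm]
        · simp [g]
        · exact (Continuous.smul (ContinuousMap.continuous _) hcont).integrable_of_hasCompactSupport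
            (HasCompactSupport.of_compactSpace _)
      rw [e, key, map_zero]
    have hs := UnitAddTorus.hasSum_mFourier_series_apply_of_summable (f := g)
      (by rw [funext hg]; exact summable_zero) t
    simp only [hg, smul_eq_mul, zero_mul] at hs
    exact hs.unique hasSum_zero
  funext x
  rw [← torusLift_coe hφ, hz]
  rfl

omit [NormedSpace ℂ E] in
theorem integrableOn_unitCube {φ : (ι → ℝ) → E} (hc : Continuous φ) :
    IntegrableOn φ (unitCube ι) :=
  (hc.continuousOn.integrableOn_compact isCompact_Icc).mono_set unitCube_subset

theorem integral_exp_int (m : ℤ) :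
    ∫ t in (0 : ℝ)..1, Complex.exp (2 * Real.pi * Complex.I * (m * t)) = if m = 0 then 1 else 0 := by
  split_ifs with h
  · simp [h]
  · have hc : (2 * Real.pi * Complex.I * m : ℂ) ≠ 0 := by
      simp [h, Real.pi_ne_zero]
    simp only [← mul_assoc]
    rw [integral_exp_mul_complex hc]
    have : Complex.exp (2 * Real.pi * Complex.I * m) = 1 :=
      Complex.exp_eq_one_iff.2 ⟨m, by ring⟩
    simp [this]

theorem character_single [DecidableEq ι] (k : ι → ℤ) (q : ι) (t : ℝ) :
    character k (Pi.single q t) = Complex.exp (2 * Real.pi * Complex.I * (k q * t)) := by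
  unfold character
  rw [Finset.sum_eq_single q]
  · simp
  · intro b _ hb
    simp [hb]
  · simp

/-- By Fubini the coefficient moves inside the integral over `t`, where translation multiplies it by
exp(2πi (k q) t); orthogonality of exponentials selects `k q = m`. -/
theorem cubeCoeff_integral_translate [CompleteSpace E] [DecidableEq ι] {φ : (ι → ℝ) → E}
    (hφ : IsIntPeriodic φ) (hc : Continuous φ) (q : ι) (m : ℤ) (k : ι → ℤ) :
    cubeCoeff (fun x => ∫ t in (0 : ℝ)..1,
      Complex.exp (2 * Real.pi * Complex.I * ((-m : ℤ) * t)) • φ (x + Pi.single q t)) k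
      = if k q = m then cubeCoeff φ k else 0 := by
  have hcont : Continuous fun z : (ι → ℝ) × ℝ => character (-k) z.1 •
      Complex.exp (2 * Real.pi * Complex.I * ((-m : ℤ) * z.2)) • φ (z.1 + Pi.single q z.2) := by
    refine ((continuous_character (-k)).comp continuous_fst).smul (Continuous.smul ?_
      (hc.comp (continuous_fst.add ((continuous_single q).comp continuous_snd))))
    fun_prop
  have hint : Integrable (Function.uncurry fun (x : ι → ℝ) (t : ℝ) => character (-k) x •
      Complex.exp (2 * Real.pi * Complex.I * ((-m : ℤ) * t)) • φ (x + Pi.single q t))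
      ((volume.restrict (unitCube ι)).prod (volume.restrict (Set.Ioc 0 1))) := by
    rw [Measure.prod_restrict]
    exact (hcont.continuousOn.integrableOn_compact
      (isCompact_Icc.prod isCompact_Icc)).mono_set
      (Set.prod_mono unitCube_subset Set.Ioc_subset_Icc_self)
  unfold cubeCoeff
  simp only [intervalIntegral.integral_of_le zero_le_one, ← integral_smul]
  rw [integral_integral_swap hint]
  simp only [smul_comm (character (-k) _) (Complex.exp _), integral_smul]
  change ∫ t in Set.Ioc (0 : ℝ) 1, Complex.exp _ • cubeCoeff (fun x => φ (x + Pi.single q t)) k = _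
  simp only [cubeCoeff_translate hφ, character_single, smul_smul, ← Complex.exp_add, ← mul_add,
    ← add_mul]
  rw [integral_smul_const, ← intervalIntegral.integral_of_le zero_le_one]
  have := integral_exp_int (-m + k q)
  push_cast at this ⊢
  rw [this]
  by_cases h : k q = m
  · simp [h, cubeCoeff]
  · rw [if_neg h, if_neg (by omega), zero_smul]

end Periodic

/-! ### Holomorphic dependence of integrals on a parameter -/

section ParametricIntegral

open MeasureTheory Filter Topology

variable {E : Type*} [NormedAddCommGroup E] [NormedSpace ℂ E]

/-- Differentiation under the integral sign: a bound for `g` on a compact set bounds the derivative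
by Cauchy's estimate, so no hypothesis on the derivative is needed. -/
theorem differentiableOn_intervalIntegral {U : Set ℂ} (hU : IsOpen U) {g : ℂ → ℝ → E}
    (hc : ContinuousOn (Function.uncurry g) (U ×ˢ Set.univ))
    (hd : ∀ t, DifferentiableOn ℂ (fun s => g s t) U) :
    DifferentiableOn ℂ (fun s => ∫ t in (0 : ℝ)..1, g s t) U := by
  intro s₀ hs₀
  refine DifferentiableAt.differentiableWithinAt ?_
  -- Radius `2 * r`, so that circles of radius `r` around points of the ball of radius `r` stay
  -- inside the region of the bound.
  obtain ⟨r, hr, hrU⟩ : ∃ r > 0, Metric.closedBall s₀ (2 * r) ⊆ U := by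
    obtain ⟨r, hr, h⟩ := Metric.nhds_basis_closedBall.mem_iff.1 (hU.mem_nhds hs₀)
    exact ⟨r / 2, half_pos hr, by rwa [mul_div_cancel₀ r two_ne_zero]⟩
  obtain ⟨C, hC⟩ := ((isCompact_closedBall s₀ (2 * r)).prod
    (isCompact_Icc (a := (0 : ℝ)) (b := 1))).exists_bound_of_continuousOn
    (hc.mono (Set.prod_mono hrU (Set.subset_univ _)))
  have hslice : ∀ s ∈ U, Continuous (g s) := fun s hs =>
    hc.comp_continuous (f := fun t => (s, t)) (by fun_prop) fun t => ⟨hs, trivial⟩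
  have hball : Metric.ball s₀ r ⊆ U := fun s hs => hrU <| by
    have := Metric.mem_ball.1 hs
    exact Metric.mem_closedBall.2 (by linarith)
  have hderiv : ∀ t, ∀ s ∈ U, HasDerivAt (fun s => g s t) (deriv (fun s => g s t) s) s :=
    fun t s hs => ((hd t).differentiableAt (hU.mem_nhds hs)).hasDerivAt
  -- The derivative is a pointwise limit of difference quotients, each continuous in `t`.
  have hmeas : AEStronglyMeasurable (fun t => deriv (fun s => g s t) s₀)
      (volume.restrict (Set.uIoc (0 : ℝ) 1)) := by
    have hseq : Tendsto (fun k : ℕ => s₀ + ((r / (k + 1) : ℝ) : ℂ)) atTop (𝓝[≠] s₀) := by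
      rw [tendsto_nhdsWithin_iff]
      refine ⟨?_, Eventually.of_forall fun k => ?_⟩
      · have h1 : Tendsto (fun k : ℕ => r / ((k : ℝ) + 1)) atTop (𝓝 0) :=
          tendsto_const_div_atTop_nhds_zero_nat r |>.comp (tendsto_add_atTop_nat 1) |>.congr
            fun k => by simp
        have h2 := (Complex.continuous_ofReal.tendsto 0).comp h1
        simpa using h2.const_add s₀
      · simp only [Set.mem_compl_iff, Set.mem_singleton_iff, add_eq_left, Complex.ofReal_eq_zero]
        positivity
    refine aestronglyMeasurable_of_tendsto_ae atTop
      (f := fun (k : ℕ) t => slope (fun s => g s t) s₀ (s₀ + ((r / (k + 1) : ℝ) : ℂ)))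
      (fun k => ?_) (Eventually.of_forall fun t =>
        (hasDerivAt_iff_tendsto_slope.1 (hderiv t s₀ hs₀)).comp hseq)
    refine Continuous.aestronglyMeasurable ?_
    have h1 : s₀ + ((r / (k + 1) : ℝ) : ℂ) ∈ U := hrU <| by
      rw [Metric.mem_closedBall, dist_eq_norm, add_sub_cancel_left, Complex.norm_real,
        Real.norm_of_nonneg (by positivity), div_le_iff₀ (by positivity)]
      nlinarith [(Nat.cast_nonneg k : (0 : ℝ) ≤ k)]
    simp only [slope_def_module]
    exact ((hslice _ h1).sub (hslice _ hs₀)).const_smul _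
  refine (intervalIntegral.hasDerivAt_integral_of_dominated_loc_of_deriv_le
    (F' := fun s t => deriv (fun s => g s t) s) (bound := fun _ => C / r)
    (Metric.ball_mem_nhds s₀ hr) ?_ ((hslice s₀ hs₀).intervalIntegrable _ _) hmeas ?_
    intervalIntegrable_const ?_).2.differentiableAt
  · filter_upwards [hU.mem_nhds hs₀] with s hs
    exact (hslice s hs).aestronglyMeasurable
  · refine Eventually.of_forall fun t ht s hs => ?_
    rw [Set.uIoc_of_le zero_le_one] at ht
    have hsub : Metric.closedBall s r ⊆ Metric.closedBall s₀ (2 * r) := by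
      refine Metric.closedBall_subset_closedBall' ?_
      have := Metric.mem_ball.1 hs
      linarith
    refine Complex.norm_deriv_le_of_forall_mem_sphere_norm_le hr
      (((hd t).mono (hsub.trans hrU)).diffContOnCl_ball subset_rfl) fun z hz => ?_
    exact hC (z, t) ⟨hsub (Metric.sphere_subset_closedBall hz), ht.1.le, ht.2⟩
  · exact Eventually.of_forall fun t _ s hs => hderiv t s (hball hs)

end ParametricIntegral

/-! ### The action of the real symplectic group -/

section RealAction

variable {n : ℕ}

/-- The real symplectic group. -/
abbrev RealSp (n : ℕ) : Type := Matrix.symplecticGroup (Fin n) ℝ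

/-- A real symplectic matrix, viewed as a complex matrix. -/
def complexify (g : RealSp n) : Matrix (Fin n ⊕ Fin n) (Fin n ⊕ Fin n) ℂ :=
  g.1.map Complex.ofRealHom

/-- `A Z + B` for a real symplectic matrix. -/
def realNum (g : RealSp n) (Z : Matrix (Fin n) (Fin n) ℂ) : Matrix (Fin n) (Fin n) ℂ :=
  (complexify g).toBlocks₁₁ * Z + (complexify g).toBlocks₁₂

/-- `C Z + D` for a real symplectic matrix. -/
def realDenom (g : RealSp n) (Z : Matrix (Fin n) (Fin n) ℂ) : Matrix (Fin n) (Fin n) ℂ :=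
  (complexify g).toBlocks₂₁ * Z + (complexify g).toBlocks₂₂

theorem complexify_mul (g h : RealSp n) : complexify (g * h) = complexify g * complexify h :=
  Matrix.map_mul

theorem complexify_relations (g : RealSp n) :
    let A := (complexify g).toBlocks₁₁
    let B := (complexify g).toBlocks₁₂
    let C := (complexify g).toBlocks₂₁
    let D := (complexify g).toBlocks₂₂
    Aᵀ * C = Cᵀ * A ∧ Bᵀ * D = Dᵀ * B ∧ Aᵀ * D - Cᵀ * B = 1 := by
  have h := SymplecticGroup.map_mem g.2 Complex.ofRealHom
  change complexify g ∈ _ at h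
  rw [← fromBlocks_toBlocks (complexify g)] at h
  exact SymplecticGroup.fromBlocks_mem_iff.1 h

theorem realNum_transpose_mul_realDenom (g : RealSp n) {Z : Matrix (Fin n) (Fin n) ℂ}
    (hZ : Z.IsSymm) : (realNum g Z)ᵀ * realDenom g Z = (realDenom g Z)ᵀ * realNum g Z := by
  obtain ⟨h1, h2, h3⟩ := complexify_relations g
  have h3' := congrArg Matrix.transpose h3
  simp only [transpose_sub, transpose_mul, transpose_transpose, transpose_one] at h3'
  unfold realNum realDenom
  set A := (complexify g).toBlocks₁₁
  set B := (complexify g).toBlocks₁₂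
  set C := (complexify g).toBlocks₂₁
  set D := (complexify g).toBlocks₂₂
  have key : (A * Z + B)ᵀ * (C * Z + D) - (C * Z + D)ᵀ * (A * Z + B)
      = Z * (Aᵀ * C - Cᵀ * A) * Z + (Bᵀ * D - Dᵀ * B) + Z * (Aᵀ * D - Cᵀ * B)
        - (Dᵀ * A - Bᵀ * C) * Z := by
    simp only [transpose_add, transpose_mul, hZ.eq]
    noncomm_ring
  rw [h1, h2, h3, h3'] at key
  exact sub_eq_zero.1 (by rw [key]; simp)

/-- The right side is `2i` times the imaginary part of a symmetric `Z`; this identity controls both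
invertibility of `CZ + D` and positivity of the new imaginary part. -/
theorem realDenom_conjTranspose_mul_realNum (g : RealSp n) (Z : Matrix (Fin n) (Fin n) ℂ) :
    (realDenom g Z)ᴴ * realNum g Z - (realNum g Z)ᴴ * realDenom g Z = Z - Zᴴ := by
  obtain ⟨h1, h2, h3⟩ := complexify_relations g
  have h3' := congrArg Matrix.transpose h3
  simp only [transpose_sub, transpose_mul, transpose_transpose, transpose_one] at h3'
  have c11 : (complexify g).toBlocks₁₁ᴴ = (complexify g).toBlocks₁₁ᵀ := by
    ext i j; simp [complexify, toBlocks₁₁]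
  have c12 : (complexify g).toBlocks₁₂ᴴ = (complexify g).toBlocks₁₂ᵀ := by
    ext i j; simp [complexify, toBlocks₁₂]
  have c21 : (complexify g).toBlocks₂₁ᴴ = (complexify g).toBlocks₂₁ᵀ := by
    ext i j; simp [complexify, toBlocks₂₁]
  have c22 : (complexify g).toBlocks₂₂ᴴ = (complexify g).toBlocks₂₂ᵀ := by
    ext i j; simp [complexify, toBlocks₂₂]
  unfold realNum realDenom
  have key : ∀ A B C D W : Matrix (Fin n) (Fin n) ℂ,
      (W * Cᵀ + Dᵀ) * (A * Z + B) - (W * Aᵀ + Bᵀ) * (C * Z + D)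
      = W * (Cᵀ * A - Aᵀ * C) * Z + (Dᵀ * B - Bᵀ * D) + (Dᵀ * A - Bᵀ * C) * Z
        - W * (Aᵀ * D - Cᵀ * B) := by
    intro A B C D W
    noncomm_ring
  rw [conjTranspose_add, conjTranspose_add, conjTranspose_mul, conjTranspose_mul,
    c11, c12, c21, c22, key, h1, h2, h3, h3']
  simp

-- A kernel vector `v` of `CZ + D` would give `v* (Z - Z*) v = 0`, against positivity of the
-- imaginary part.
open scoped ComplexOrder in
theorem realDenom_det_ne_zero (g : RealSp n) {Z : Matrix (Fin n) (Fin n) ℂ}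
    (hZ : Z ∈ upperHalfSpace n) : (realDenom g Z).det ≠ 0 := by
  intro h0
  obtain ⟨v, hv, hv0⟩ := exists_mulVec_eq_zero_iff.2 h0
  have key := realDenom_conjTranspose_mul_realNum g Z
  rw [sub_conjTranspose_eq hZ.1] at key
  have hpos := (posDef_map_ofReal.2 hZ.2).dotProduct_mulVec_pos hv
  have k2 := congrArg (fun M => star v ⬝ᵥ M *ᵥ v) key
  have k3 : star v ᵥ* (realDenom g Z)ᴴ = 0 := by
    rw [← star_mulVec, hv0, star_zero]
  simp only [sub_mulVec, smul_mulVec, dotProduct_smul, ← mulVec_mulVec, hv0,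
    mulVec_zero, sub_zero] at k2
  rw [dotProduct_mulVec, k3, zero_dotProduct] at k2
  have : (2 * Complex.I) ≠ 0 := by simp
  rcases smul_eq_zero.1 k2.symm with h | h
  · exact this h
  · exact hpos.ne' h

/-- The automorphy factor `C Z + D` of a real symplectic matrix. -/
def realDenomGL (g : RealSp n) (Z : upperHalfSpace n) : GL (Fin n) ℂ :=
  Matrix.GeneralLinearGroup.mkOfDetNeZero (realDenom g Z) (realDenom_det_ne_zero g Z.2)

-- With `Q = CZ + D`, the imaginary part of the image is `Q⁻* (Im Z) Q⁻¹`.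
open scoped ComplexOrder in
theorem realAction_mem (g : RealSp n) (Z : upperHalfSpace n) :
    realNum g Z * (realDenom g Z)⁻¹ ∈ upperHalfSpace n := by
  have hdet : IsUnit (realDenom g Z.1).det := (realDenom_det_ne_zero g Z.2).isUnit
  have h1 := realNum_transpose_mul_realDenom g Z.2.1
  have h2 := realDenom_conjTranspose_mul_realNum g Z.1
  rw [sub_conjTranspose_eq Z.2.1] at h2
  set P := realNum g Z.1
  set Q := realDenom g Z.1
  have hQ : Q * Q⁻¹ = 1 := mul_nonsing_inv _ hdet
  have hQt : (Q⁻¹)ᵀ * Qᵀ = 1 := by rw [← transpose_mul, hQ, transpose_one]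
  have hQh : (Q⁻¹)ᴴ * Qᴴ = 1 := by rw [← conjTranspose_mul, hQ, conjTranspose_one]
  have hs : (P * Q⁻¹).IsSymm := by
    unfold Matrix.IsSymm
    calc (P * Q⁻¹)ᵀ = (Q⁻¹)ᵀ * (Pᵀ * Q) * Q⁻¹ := by
          rw [transpose_mul, Matrix.mul_assoc, Matrix.mul_assoc, hQ, Matrix.mul_one]
      _ = P * Q⁻¹ := by
          rw [h1, ← Matrix.mul_assoc, hQt, Matrix.one_mul]
  refine ⟨hs, ?_⟩
  rw [← posDef_map_ofReal]
  have e : (2 * Complex.I) • ((P * Q⁻¹).map Complex.im).map ((↑) : ℝ → ℂ)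
      = (2 * Complex.I) • ((Q⁻¹)ᴴ * (Z.1.map Complex.im).map ((↑) : ℝ → ℂ) * Q⁻¹) := by
    rw [← sub_conjTranspose_eq hs, ← Matrix.smul_mul, ← Matrix.mul_smul, ← h2, Matrix.mul_sub,
      Matrix.sub_mul, ← Matrix.mul_assoc, hQh, Matrix.one_mul, conjTranspose_mul,
      ← Matrix.mul_assoc, Matrix.mul_assoc _ Q, hQ, Matrix.mul_one]
  rw [smul_right_injective _ (by simp : (2 * Complex.I) ≠ 0) e]
  refine (posDef_map_ofReal.2 Z.2.2).conjTranspose_mul_mul_same ?_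
  exact mulVec_injective_of_isUnit ((isUnit_nonsing_inv_iff).2 ((isUnit_iff_isUnit_det _).2 hdet))

/-- The action `(A Z + B)(C Z + D)⁻¹` of the real symplectic group. -/
def realAction (g : RealSp n) (Z : upperHalfSpace n) : upperHalfSpace n :=
  ⟨realNum g Z * (realDenom g Z)⁻¹, realAction_mem g Z⟩

/-- The column of `AZ + B` over `CZ + D` is the column of the image point over 1, times `CZ + D`.
The cocycle relation and the action law follow by multiplying matrices. -/
theorem realNum_eq (g : RealSp n) (Z : upperHalfSpace n) :
    realNum g Z = (realAction g Z).1 * realDenom g Z := by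
  change _ = realNum g Z * (realDenom g Z)⁻¹ * realDenom g Z
  rw [Matrix.mul_assoc, nonsing_inv_mul _ (realDenom_det_ne_zero g Z.2).isUnit, Matrix.mul_one]

theorem realNum_mul_aux (g h : RealSp n) (Z : Matrix (Fin n) (Fin n) ℂ) :
    realNum (g * h) Z = (complexify g).toBlocks₁₁ * realNum h Z
      + (complexify g).toBlocks₁₂ * realDenom h Z := by
  have e : complexify (g * h) = _ := complexify_mul g h
  rw [← fromBlocks_toBlocks (complexify g), ← fromBlocks_toBlocks (complexify h),
    fromBlocks_multiply] at e
  unfold realNum realDenom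
  rw [e]
  simp only [toBlocks_fromBlocks₁₁, toBlocks_fromBlocks₁₂]
  noncomm_ring

theorem realDenom_mul_aux (g h : RealSp n) (Z : Matrix (Fin n) (Fin n) ℂ) :
    realDenom (g * h) Z = (complexify g).toBlocks₂₁ * realNum h Z
      + (complexify g).toBlocks₂₂ * realDenom h Z := by
  have e : complexify (g * h) = _ := complexify_mul g h
  rw [← fromBlocks_toBlocks (complexify g), ← fromBlocks_toBlocks (complexify h),
    fromBlocks_multiply] at e
  unfold realNum realDenom
  rw [e]
  simp only [toBlocks_fromBlocks₂₁, toBlocks_fromBlocks₂₂]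
  noncomm_ring

theorem realDenom_mul (g h : RealSp n) (Z : upperHalfSpace n) :
    realDenom (g * h) Z = realDenom g (realAction h Z) * realDenom h Z := by
  rw [realDenom_mul_aux, realNum_eq h Z, ← Matrix.mul_assoc, ← Matrix.add_mul]
  rfl

theorem realNum_mul (g h : RealSp n) (Z : upperHalfSpace n) :
    realNum (g * h) Z = realNum g (realAction h Z) * realDenom h Z := by
  rw [realNum_mul_aux, realNum_eq h Z, ← Matrix.mul_assoc, ← Matrix.add_mul]
  rfl

theorem realAction_mul (g h : RealSp n) (Z : upperHalfSpace n) :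
    realAction (g * h) Z = realAction g (realAction h Z) := by
  apply Subtype.ext
  change realNum (g * h) Z * (realDenom (g * h) Z)⁻¹
    = realNum g (realAction h Z) * (realDenom g (realAction h Z))⁻¹
  rw [realNum_mul, realDenom_mul, Matrix.mul_inv_rev, Matrix.mul_assoc,
    mul_nonsing_inv_cancel_left _ _ (realDenom_det_ne_zero h Z.2).isUnit]

theorem realDenomGL_mul (g h : RealSp n) (Z : upperHalfSpace n) :
    realDenomGL (g * h) Z = realDenomGL g (realAction h Z) * realDenomGL h Z :=
  Units.ext (realDenom_mul g h Z)

variable {V : Type*} [NormedAddCommGroup V] [NormedSpace ℂ V]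

/-- The slash operator of a real symplectic matrix, as a linear map. -/
def realSlash (ρ : Representation ℂ (GL (Fin n) ℂ) V) (g : RealSp n) :
    (upperHalfSpace n → V) →ₗ[ℂ] (upperHalfSpace n → V) where
  toFun f Z := ρ (realDenomGL g Z)⁻¹ (f (realAction g Z))
  map_add' f f' := by
    funext Z
    simp
  map_smul' c f := by
    funext Z
    simp

theorem realSlash_apply (ρ : Representation ℂ (GL (Fin n) ℂ) V) (g : RealSp n)
    (f : upperHalfSpace n → V) (Z : upperHalfSpace n) :
    realSlash ρ g f Z = ρ (realDenomGL g Z)⁻¹ (f (realAction g Z)) := rfl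

/-- A right action. Real rather than integral matrices are required because the sieve uses
translations by `1 / p`. -/
theorem realSlash_mul (ρ : Representation ℂ (GL (Fin n) ℂ) V) (g h : RealSp n)
    (f : upperHalfSpace n → V) : realSlash ρ (g * h) f = realSlash ρ h (realSlash ρ g f) := by
  funext Z
  simp only [realSlash_apply, realDenomGL_mul, realAction_mul, _root_.mul_inv_rev, map_mul,
    Module.End.mul_apply]

/-- Integral symplectic matrices as real ones. -/
def toRealSp (g : Sp n) : RealSp n :=
  ⟨g.1.map (Int.castRingHom ℝ), SymplecticGroup.map_mem g.2 _⟩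

theorem realSlash_toRealSp (ρ : Representation ℂ (GL (Fin n) ℂ) V) (g : Sp n)
    (f : upperHalfSpace n → V) : realSlash ρ (toRealSp g) f = slash ρ f g := by
  have hn : ∀ Z, realNum (toRealSp g) Z = num g Z := by
    intro Z
    unfold realNum num
    rfl
  have hd : ∀ Z, realDenom (toRealSp g) Z = denom g Z := by
    intro Z
    unfold realDenom denom
    rfl
  funext Z
  have e1 : realAction (toRealSp g) Z = action g Z := by
    apply Subtype.ext
    change realNum _ _ * (realDenom _ _)⁻¹ = num _ _ * (denom _ _)⁻¹
    rw [hn, hd]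
  have e2 : realDenomGL (toRealSp g) Z = denomGL g Z := Units.ext (hd Z)
  rw [realSlash_apply, slash, e1, e2]

/-! ### Translations -/

theorem symMat_isSymm {R : Type*} (x : Sym2 (Fin n) → R) : (symMat x).IsSymm := by
  ext i j
  simp [symMat, Sym2.eq_swap]

/-- The translation `Z ↦ Z + X` by the real symmetric matrix with coordinates `x`. -/
def translation (x : Sym2 (Fin n) → ℝ) : RealSp n :=
  ⟨fromBlocks 1 (symMat x) 0 1, SymplecticGroup.fromBlocks_mem_iff.2 <| by
    simp [(symMat_isSymm x).eq]⟩

theorem translation_coe (x : Sym2 (Fin n) → ℝ) :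
    (translation x).1 = fromBlocks 1 (symMat x) 0 1 := rfl

theorem realDenom_translation (x : Sym2 (Fin n) → ℝ) (Z : Matrix (Fin n) (Fin n) ℂ) :
    realDenom (translation x) Z = 1 := by
  have h1 : (complexify (translation x)).toBlocks₂₁ = 0 := by
    ext; simp [complexify, translation, toBlocks₂₁]
  have h2 : (complexify (translation x)).toBlocks₂₂ = 1 := by
    ext i j; by_cases h : i = j <;> simp [complexify, translation, toBlocks₂₂, Matrix.one_apply, h]
  rw [realDenom, h1, h2, Matrix.zero_mul, zero_add]

theorem realAction_translation (x : Sym2 (Fin n) → ℝ) (Z : upperHalfSpace n) :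
    (realAction (translation x) Z).1 = Z.1 + (symMat x).map ((↑) : ℝ → ℂ) := by
  change realNum _ _ * (realDenom _ _)⁻¹ = _
  have h1 : (complexify (translation x)).toBlocks₁₁ = 1 := by
    ext i j; by_cases h : i = j <;> simp [complexify, translation, toBlocks₁₁, Matrix.one_apply, h]
  have h2 : (complexify (translation x)).toBlocks₁₂ = (symMat x).map ((↑) : ℝ → ℂ) := by
    ext i j; simp [complexify, translation, toBlocks₁₂]
  rw [realDenom_translation, inv_one, Matrix.mul_one, realNum, h1, h2, Matrix.one_mul]

theorem realDenomGL_translation (x : Sym2 (Fin n) → ℝ) (Z : upperHalfSpace n) :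
    realDenomGL (translation x) Z = 1 :=
  Units.ext (realDenom_translation x Z)

theorem realSlash_translation (ρ : Representation ℂ (GL (Fin n) ℂ) V) (x : Sym2 (Fin n) → ℝ)
    (f : upperHalfSpace n → V) (Z : upperHalfSpace n) :
    realSlash ρ (translation x) f Z = f (realAction (translation x) Z) := by
  rw [realSlash_apply, realDenomGL_translation, inv_one, map_one, Module.End.one_apply]

theorem symMat_add {R : Type*} [Add R] (x y : Sym2 (Fin n) → R) :
    symMat (x + y) = symMat x + symMat y := by
  ext i j
  simp [symMat]

theorem translation_add (x y : Sym2 (Fin n) → ℝ) :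
    translation (x + y) = translation x * translation y := by
  apply Subtype.ext
  change fromBlocks _ _ _ _ = fromBlocks _ _ _ _ * fromBlocks _ _ _ _
  rw [fromBlocks_multiply, symMat_add]
  simp [add_comm]

/-! ### The embedded `SL₂` -/

section Embedding

variable {R : Type*} [CommRing R]

/-- The embedding of `SL₂` into the symplectic group at the `i`-th coordinate. -/
def embedSL2 (i : Fin n) : SpecialLinearGroup (Fin 2) R →* symplecticGroup (Fin n) R where
  toFun g := ⟨fromBlocks (diagonal (Function.update 1 i (g 0 0))) (diagonal (Pi.single i (g 0 1)))
      (diagonal (Pi.single i (g 1 0))) (diagonal (Function.update 1 i (g 1 1))), by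
    rw [SymplecticGroup.fromBlocks_mem_iff]
    have hdet := g.det_coe
    rw [det_fin_two] at hdet
    simp only [diagonal_transpose, diagonal_mul_diagonal, diagonal_sub, ← diagonal_one]
    refine ⟨?_, ?_, ?_⟩ <;> congr 1 <;> funext k <;> by_cases h : k = i
    · subst h; simp [mul_comm]
    · simp [h]
    · subst h; simp [mul_comm]
    · simp [h]
    · subst h; simp; linear_combination hdet
    · simp [h]⟩
  map_one' := by
    apply Subtype.ext
    change fromBlocks _ _ _ _ = _
    simp [← fromBlocks_one]
  map_mul' g h := by
    apply Subtype.ext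
    change fromBlocks _ _ _ _ = fromBlocks _ _ _ _ * fromBlocks _ _ _ _
    rw [fromBlocks_multiply]
    simp only [diagonal_mul_diagonal, diagonal_add]
    congr 2 <;> funext k <;> by_cases hk : k = i
    · subst hk; simp [Matrix.mul_apply, Fin.sum_univ_two]
    · simp [hk]
    · subst hk; simp [Matrix.mul_apply, Fin.sum_univ_two]
    · simp [hk]
    · subst hk; simp [Matrix.mul_apply, Fin.sum_univ_two]
    · simp [hk]
    · subst hk; simp [Matrix.mul_apply, Fin.sum_univ_two]
    · simp [hk]

theorem embedSL2_coe (i : Fin n) (g : SpecialLinearGroup (Fin 2) R) :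
    (embedSL2 i g).1 = fromBlocks (diagonal (Function.update 1 i (g 0 0)))
      (diagonal (Pi.single i (g 0 1))) (diagonal (Pi.single i (g 1 0)))
      (diagonal (Function.update 1 i (g 1 1))) := rfl

theorem blockC_embedSL2 (i : Fin n) (g : SpecialLinearGroup (Fin 2) ℤ) :
    blockC (embedSL2 i g) = diagonal (Pi.single i (g 1 0)) := by
  rw [blockC, embedSL2_coe, toBlocks_fromBlocks₂₁]

/-- Turns the factor `χ (det D)` into the one-variable nebentypus `χ d`. -/
theorem blockD_embedSL2_det (i : Fin n) (g : SpecialLinearGroup (Fin 2) ℤ) :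
    (blockD (embedSL2 i g)).det = g 1 1 := by
  rw [blockD, embedSL2_coe, toBlocks_fromBlocks₂₂, det_diagonal,
    Finset.prod_update_of_mem (Finset.mem_univ i)]
  simp

theorem toRealSp_embedSL2 (i : Fin n) (g : SpecialLinearGroup (Fin 2) ℤ) :
    toRealSp (embedSL2 i g) = embedSL2 i (g.map (Int.castRingHom ℝ)) := by
  apply Subtype.ext
  change (embedSL2 i g).1.map _ = _
  rw [embedSL2_coe, embedSL2_coe, fromBlocks_map]
  simp only [diagonal_map (map_zero (Int.castRingHom ℝ))]
  congr 2 <;> funext k <;> by_cases hk : k = i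
  · subst hk; simp
  · simp [hk]
  · subst hk; simp
  · simp [hk]
  · subst hk; simp
  · simp [hk]
  · subst hk; simp
  · simp [hk]

end Embedding

theorem symMat_single (j : Fin n) (t : ℝ) :
    symMat (Pi.single s(j, j) t) = diagonal (Pi.single j t) := by
  ext a b
  by_cases h : a = b
  · subst h
    by_cases h' : a = j
    · subst h'; simp [symMat]
    · simp [symMat, h', Pi.single_apply]
  · have : ¬ (a = j ∧ b = j) := fun hc => h (hc.1.trans hc.2.symm)
    simp [symMat, h, Pi.single_apply, this]

/-- The unipotent matrix with upper right entry `s`. -/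
def upperSL2 (s : ℝ) : SpecialLinearGroup (Fin 2) ℝ := ⟨!![1, s; 0, 1], by simp⟩

theorem embedSL2_upperSL2 (i : Fin n) (s : ℝ) :
    embedSL2 i (upperSL2 s) = translation (Pi.single s(i, i) s) := by
  apply Subtype.ext
  rw [embedSL2_coe, translation_coe, symMat_single]
  simp [upperSL2]

/-- The two matrices act in different coordinates. This is where a second diagonal entry enters. -/
theorem translation_mul_embedSL2 {i j : Fin n} (hij : i ≠ j) (t : ℝ)
    (g : SpecialLinearGroup (Fin 2) ℝ) :
    translation (Pi.single s(j, j) t) * embedSL2 i g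
      = embedSL2 i g * translation (Pi.single s(j, j) t) := by
  apply Subtype.ext
  change (translation _).1 * (embedSL2 i g).1 = (embedSL2 i g).1 * (translation _).1
  rw [embedSL2_coe, translation_coe, symMat_single, fromBlocks_multiply, fromBlocks_multiply]
  simp only [← diagonal_one, ← diagonal_zero, diagonal_mul_diagonal, diagonal_add]
  congr 2 <;> funext k <;> by_cases hk : k = i
  · subst hk; simp [hij]
  · simp [hk]
  · subst hk; simp [hij]
  · simp [hk, add_comm]
  · subst hk; simp
  · simp [hk]
  · subst hk; simp [hij]
  · simp [hk]

end RealAction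

/-! ### Functions on the upper half-space in linear coordinates -/

section Coordinates

open Topology

variable {n : ℕ} {V : Type*} [NormedAddCommGroup V] [NormedSpace ℂ V]

/-- The Siegel upper half-space in linear coordinates. -/
def coordDomain (n : ℕ) : Set (Sym2 (Fin n) → ℂ) := {z | symMat z ∈ upperHalfSpace n}

/-- The coordinates of a point of the Siegel upper half-space. -/
def coords (Z : upperHalfSpace n) (p : Sym2 (Fin n)) : ℂ :=
  Sym2.lift ⟨fun a b => Z.1 a b, fun a b => Z.2.1.apply b a⟩ p

theorem symMat_coords (Z : upperHalfSpace n) : symMat (coords Z) = Z.1 := by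
  ext a b
  simp [symMat, coords]

theorem coords_mem (Z : upperHalfSpace n) : coords Z ∈ coordDomain n := by
  change symMat (coords Z) ∈ upperHalfSpace n
  rw [symMat_coords]
  exact Z.2

theorem continuous_coords : Continuous (coords (n := n)) := by
  refine continuous_pi fun p => ?_
  induction p with
  | _ a b =>
    change Continuous fun Z : upperHalfSpace n => Z.1 a b
    exact (continuous_apply_apply a b).comp continuous_subtype_val

open Classical in
/-- The extension by zero of a function on the upper half-space, in linear coordinates. -/
def extend (f : upperHalfSpace n → V) (z : Sym2 (Fin n) → ℂ) : V :=
  if h : symMat z ∈ upperHalfSpace n then f ⟨symMat z, h⟩ else 0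

omit [NormedSpace ℂ V] in
theorem extend_of_mem (f : upperHalfSpace n → V) {z : Sym2 (Fin n) → ℂ} (h : z ∈ coordDomain n) :
    extend f z = f ⟨symMat z, h⟩ := dif_pos h

omit [NormedSpace ℂ V] in
theorem extend_coords (f : upperHalfSpace n → V) (Z : upperHalfSpace n) :
    extend f (coords Z) = f Z := by
  rw [extend_of_mem f (coords_mem Z)]
  exact congrArg f (Subtype.ext (symMat_coords Z))

theorem continuous_symMat {R : Type*} [TopologicalSpace R] :
    Continuous (symMat : (Sym2 (Fin n) → R) → Matrix (Fin n) (Fin n) R) :=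
  continuous_matrix fun _ _ => continuous_apply _

/-- By homogeneity, positivity need only be tested on the unit sphere; the sphere is compact, so
positivity persists nearby. -/
theorem isOpen_posDef_symMat : IsOpen {y : Sym2 (Fin n) → ℝ | (symMat y).PosDef} := by
  have hset : {y : Sym2 (Fin n) → ℝ | (symMat y).PosDef}
      = {y | ∀ v ∈ Metric.sphere (0 : Fin n → ℝ) 1, 0 < v ⬝ᵥ symMat y *ᵥ v} := by
    ext y
    constructor
    · intro h v hv
      exact h.dotProduct_mulVec_pos (x := v) (fun h0 => by simp [h0] at hv)
    · intro h
      refine PosDef.of_dotProduct_mulVec_pos ?_ fun v hv => ?_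
      · rw [IsHermitian, conjTranspose_eq_transpose_of_trivial]
        exact symMat_isSymm y
      · have hv' : ‖v‖ ≠ 0 := norm_ne_zero_iff.2 hv
        have := h (‖v‖⁻¹ • v) (by simp [norm_smul, hv'])
        rw [mulVec_smul, dotProduct_smul, smul_dotProduct, smul_smul, smul_eq_mul] at this
        exact pos_of_mul_pos_right this (by positivity)
  rw [hset, isOpen_iff_mem_nhds]
  intro y hy
  refine (isCompact_sphere (0 : Fin n → ℝ) 1).eventually_forall_of_forall_eventually
    (P := fun y v => 0 < v ⬝ᵥ symMat y *ᵥ v) fun v hv => ?_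
  have hc : Continuous fun z : (Sym2 (Fin n) → ℝ) × (Fin n → ℝ) => z.2 ⬝ᵥ symMat z.1 *ᵥ z.2 :=
    continuous_snd.dotProduct ((continuous_symMat.comp continuous_fst).matrix_mulVec continuous_snd)
  exact (isOpen_lt continuous_const hc).mem_nhds (hy v hv)

theorem mem_coordDomain {z : Sym2 (Fin n) → ℂ} :
    z ∈ coordDomain n ↔ (symMat fun p => (z p).im).PosDef :=
  ⟨fun h => h.2, fun h => ⟨symMat_isSymm z, h⟩⟩

theorem isOpen_coordDomain : IsOpen (coordDomain n) := by
  have : coordDomain n = (fun z p => (z p).im) ⁻¹' {y : Sym2 (Fin n) → ℝ | (symMat y).PosDef} :=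
    Set.ext fun _ => mem_coordDomain
  rw [this]
  exact isOpen_posDef_symMat.preimage (by fun_prop)

/-- Convexity makes the intersection with any complex line connected, as the identity theorem
requires. -/
theorem convex_coordDomain : Convex ℝ (coordDomain n) := by
  intro z hz w hw a b ha hb hab
  rw [mem_coordDomain] at *
  have e : (symMat fun p => ((a • z + b • w) p).im)
      = a • (symMat fun p => (z p).im) + b • (symMat fun p => (w p).im) := by
    ext; simp [symMat]
  rw [e]
  rcases ha.eq_or_lt with rfl | ha
  · rw [zero_add] at hab
    simpa [hab] using hw
  · exact (hz.smul ha).add_posSemidef (hw.posSemidef.smul hb)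

/-- The restriction of the coordinate domain to a complex line. -/
def lineDomain (z w : Sym2 (Fin n) → ℂ) : Set ℂ := {s | z + s • w ∈ coordDomain n}

theorem isOpen_lineDomain (z w : Sym2 (Fin n) → ℂ) : IsOpen (lineDomain z w) :=
  isOpen_coordDomain.preimage (by fun_prop)

theorem isPreconnected_lineDomain (z w : Sym2 (Fin n) → ℂ) : IsPreconnected (lineDomain z w) := by
  refine Convex.isPreconnected ?_
  intro s hs t ht a b ha hb hab
  have e : z + (a • s + b • t) • w = a • (z + s • w) + b • (z + t • w) := by
    rw [smul_add, smul_add, add_add_add_comm, ← add_smul, hab, one_smul, add_smul, smul_assoc,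
      smul_assoc]
  change z + (a • s + b • t) • w ∈ coordDomain n
  rw [e]
  exact convex_coordDomain hs ht ha hb hab

/-! ### Regular functions. -/

/-- Continuity together with holomorphy along all complex lines. -/
structure IsRegular (f : upperHalfSpace n → V) : Prop where
  continuous : Continuous f
  differentiableOn : ∀ z w : Sym2 (Fin n) → ℂ,
    DifferentiableOn ℂ (fun s : ℂ => extend f (z + s • w)) (lineDomain z w)

/-- Regularity suffices for the identity theorem, and its stability under Fourier-Jacobi integrals
needs only one-variable complex analysis. -/
theorem IsHolomorphic.isRegular {f : upperHalfSpace n → V} (hf : IsHolomorphic f) :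
    IsRegular f := by
  have hf' : DifferentiableOn ℂ (extend f) (coordDomain n) := hf
  refine ⟨?_, fun z w => ?_⟩
  · have e : f = extend f ∘ coords := funext fun Z => (extend_coords f Z).symm
    rw [e]
    exact hf'.continuousOn.comp_continuous continuous_coords coords_mem
  · exact hf'.comp (by fun_prop) fun s hs => hs

theorem IsRegular.continuousOn_extend {f : upperHalfSpace n → V} (hf : IsRegular f) :
    ContinuousOn (extend f) (coordDomain n) := by
  rw [continuousOn_iff_continuous_domRestrict]
  have e : (coordDomain n).domRestrict (extend f)
      = fun z => f ⟨symMat z.1, z.2⟩ := funext fun z => extend_of_mem f z.2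
  rw [e]
  exact hf.continuous.comp ((continuous_symMat.comp continuous_subtype_val).subtype_mk _)

theorem IsRegular.sub {f g : upperHalfSpace n → V} (hf : IsRegular f) (hg : IsRegular g) :
    IsRegular (f - g) := by
  refine ⟨hf.continuous.sub hg.continuous, fun z w => ?_⟩
  refine ((hf.differentiableOn z w).sub (hg.differentiableOn z w)).congr fun s hs => ?_
  simp [extend_of_mem _ hs]

theorem IsRegular.add {f g : upperHalfSpace n → V} (hf : IsRegular f) (hg : IsRegular g) :
    IsRegular (f + g) := by
  refine ⟨hf.continuous.add hg.continuous, fun z w => ?_⟩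
  refine ((hf.differentiableOn z w).add (hg.differentiableOn z w)).congr fun s hs => ?_
  simp [extend_of_mem _ hs]

theorem IsRegular.const_smul {f : upperHalfSpace n → V} (hf : IsRegular f) (c : ℂ) :
    IsRegular (c • f) := by
  refine ⟨hf.continuous.const_smul c, fun z w => ?_⟩
  refine ((hf.differentiableOn z w).const_smul c).congr fun s hs => ?_
  simp [extend_of_mem _ hs]

theorem isRegular_zero : IsRegular (0 : upperHalfSpace n → V) := by
  refine ⟨continuous_const, fun z w => ?_⟩
  exact (differentiableOn_const (0 : V)).congr fun s hs => by simp [extend_of_mem _ hs]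

theorem isRegular_sum {α : Type*} (s : Finset α) {f : α → upperHalfSpace n → V}
    (hf : ∀ a ∈ s, IsRegular (f a)) : IsRegular (∑ a ∈ s, f a) :=
  Finset.sum_induction _ IsRegular (fun _ _ => IsRegular.add) isRegular_zero hf

/-! ### Translates and Fourier-Jacobi coefficients. -/

/-- The translate of a function by a real symmetric matrix. -/
def translate (x : Sym2 (Fin n) → ℝ) (f : upperHalfSpace n → V) : upperHalfSpace n → V :=
  fun Z => f (realAction (translation x) Z)

theorem realSlash_translation_eq (ρ : Representation ℂ (GL (Fin n) ℂ) V)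
    (x : Sym2 (Fin n) → ℝ) (f : upperHalfSpace n → V) :
    realSlash ρ (translation x) f = translate x f :=
  funext fun Z => realSlash_translation ρ x f Z

omit [NormedAddCommGroup V] [NormedSpace ℂ V] in
theorem translate_translate (x y : Sym2 (Fin n) → ℝ) (f : upperHalfSpace n → V) :
    translate x (translate y f) = translate (x + y) f := by
  funext Z
  rw [translate, translate, translate, ← realAction_mul, ← translation_add, add_comm]

theorem add_ofReal_mem_coordDomain {z : Sym2 (Fin n) → ℂ} (x : Sym2 (Fin n) → ℝ) :
    (z + fun p => (x p : ℂ)) ∈ coordDomain n ↔ z ∈ coordDomain n := by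
  simp [mem_coordDomain]

-- Real translations preserve the domain, so the identity persists outside it, where both sides are
-- the default value 0.
omit [NormedSpace ℂ V] in
theorem translate_extend (x : Sym2 (Fin n) → ℝ) (f : upperHalfSpace n → V)
    (z : Sym2 (Fin n) → ℂ) : extend (translate x f) z = extend f (z + fun p => (x p : ℂ)) := by
  by_cases h : z ∈ coordDomain n
  · rw [extend_of_mem _ h, extend_of_mem _ ((add_ofReal_mem_coordDomain x).2 h), translate]
    refine congrArg f (Subtype.ext ?_)
    rw [realAction_translation]
    exact (symMat_add z fun p => (x p : ℂ)).symm
  · have h' : (z + fun p => (x p : ℂ)) ∉ coordDomain n := fun hc =>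
      h ((add_ofReal_mem_coordDomain x).1 hc)
    have e1 : extend (translate x f) z = 0 := dif_neg h
    have e2 : extend f (z + fun p => (x p : ℂ)) = 0 := dif_neg h'
    rw [e1, e2]

theorem continuous_translation_action : Continuous fun q : (Sym2 (Fin n) → ℝ) × upperHalfSpace n =>
    realAction (translation q.1) q.2 := by
  rw [continuous_induced_rng]
  have e : (Subtype.val ∘ fun q : (Sym2 (Fin n) → ℝ) × upperHalfSpace n =>
      realAction (translation q.1) q.2)
      = fun q => q.2.1 + (symMat q.1).map ((↑) : ℝ → ℂ) :=
    funext fun q => realAction_translation q.1 q.2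
  rw [e]
  exact (continuous_subtype_val.comp continuous_snd).add
    ((continuous_symMat.comp continuous_fst).matrix_map Complex.continuous_ofReal)

omit [NormedSpace ℂ V] in
theorem continuous_translate {f : upperHalfSpace n → V} (hf : Continuous f) :
    Continuous fun q : (Sym2 (Fin n) → ℝ) × upperHalfSpace n => translate q.1 f q.2 :=
  hf.comp continuous_translation_action

theorem IsRegular.translate {f : upperHalfSpace n → V} (hf : IsRegular f)
    (x : Sym2 (Fin n) → ℝ) : IsRegular (translate x f) := by
  have hx : Continuous fun Z : upperHalfSpace n => (x, Z) := by fun_prop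
  have hc := (continuous_translate hf.continuous).comp hx
  refine ⟨hc, fun z w => ?_⟩
  have e : lineDomain z w = lineDomain (z + fun p => (x p : ℂ)) w := by
    ext s
    rw [lineDomain, lineDomain, Set.mem_ofPred_eq, Set.mem_ofPred_eq, add_right_comm,
      add_ofReal_mem_coordDomain]
  simp only [translate_extend, add_right_comm _ _ (fun p => (x p : ℂ))]
  rw [e]
  exact hf.differentiableOn _ _

/-- The Fourier-Jacobi coefficient of index `m` with respect to the `j`-th diagonal entry. -/
def fourierJacobi (j : Fin n) (m : ℤ) (f : upperHalfSpace n → V) : upperHalfSpace n → V :=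
  fun Z => ∫ t in (0 : ℝ)..1, Complex.exp (2 * Real.pi * Complex.I * ((-m : ℤ) * t)) •
    translate (Pi.single s(j, j) t) f Z

theorem continuous_fourierJacobi_integrand {f : upperHalfSpace n → V} (hf : Continuous f)
    (j : Fin n) (m : ℤ) : Continuous fun q : upperHalfSpace n × ℝ =>
      Complex.exp (2 * Real.pi * Complex.I * ((-m : ℤ) * q.2)) •
        translate (Pi.single s(j, j) q.2) f q.1 := by
  have hx : Continuous fun q : upperHalfSpace n × ℝ =>
      ((Pi.single s(j, j) q.2 : Sym2 (Fin n) → ℝ), q.1) :=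
    ((continuous_single (A := fun _ => ℝ) s(j, j)).comp continuous_snd).prodMk continuous_fst
  have hc := (continuous_translate hf).comp hx
  exact Continuous.smul (by fun_prop) hc

theorem IsRegular.fourierJacobi {f : upperHalfSpace n → V} (hf : IsRegular f) (j : Fin n)
    (m : ℤ) : IsRegular (fourierJacobi j m f) := by
  refine ⟨?_, fun z w => ?_⟩
  · exact intervalIntegral.continuous_parametric_intervalIntegral_of_continuous'
      (continuous_fourierJacobi_integrand hf.continuous j m) 0 1
  · refine (differentiableOn_intervalIntegral (isOpen_lineDomain z w)
      (g := fun s t => Complex.exp (2 * Real.pi * Complex.I * ((-m : ℤ) * t)) •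
        extend (Siegel.translate (Pi.single s(j, j) t) f) (z + s • w)) ?_ fun t => ?_).congr
        fun s hs => ?_
    · simp only [translate_extend]
      refine ContinuousOn.smul (by fun_prop) (hf.continuousOn_extend.comp ?_ ?_)
      · refine Continuous.continuousOn (Continuous.add (by fun_prop) ?_)
        refine continuous_pi fun p => Complex.continuous_ofReal.comp ?_
        exact (continuous_apply p).comp
          ((continuous_single (A := fun _ => ℝ) s(j, j)).comp continuous_snd)
      · intro q hq
        exact (add_ofReal_mem_coordDomain _).2 hq.1
    · exact ((hf.translate _).differentiableOn z w).const_smul _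
    · simp only [extend_of_mem _ hs]
      rfl

/-! ### Restriction to the points `X + i`. -/

theorem horoPoint_add (x y : Sym2 (Fin n) → ℝ) :
    horoPoint (x + y) = realAction (translation y) (horoPoint x) := by
  apply Subtype.ext
  rw [realAction_translation]
  change (symMat (x + y)).map _ + _ = (symMat x).map _ + _ + _
  rw [symMat_add, Matrix.map_add _ Complex.ofReal_add, add_right_comm]

theorem continuous_horoPoint : Continuous (horoPoint (n := n)) := by
  rw [continuous_induced_rng]
  exact (continuous_symMat.matrix_map Complex.continuous_ofReal).add continuous_const

/-- A regular function that vanishes on all `X + i` vanishes. -/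
theorem IsRegular.eq_zero_of_horoPoint [CompleteSpace V] {f : upperHalfSpace n → V}
    (hf : IsRegular f) (h : ∀ x, f (horoPoint x) = 0) : f = 0 := by
  funext Z
  -- The coordinates of the identity matrix. The line `z + s w` is `Re Z + i + s (Im Z - 1)`: for
  -- real `s` it runs through points `X + i`, and at `s = i` it passes through `Z`.
  set o : Sym2 (Fin n) → ℂ := fun p => if p.IsDiag then 1 else 0 with ho
  set z : Sym2 (Fin n) → ℂ := (fun p => ((coords Z p).re : ℂ)) + Complex.I • o with hz
  set w : Sym2 (Fin n) → ℂ := (fun p => ((coords Z p).im : ℂ)) - o with hw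
  have hreal : ∀ s : ℝ, ∃ x, z + (s : ℂ) • w = coords (horoPoint x) := by
    intro s
    refine ⟨fun p => (coords Z p).re + s * ((coords Z p).im - if p.IsDiag then 1 else 0), ?_⟩
    funext p
    induction p with
    | _ a b =>
      by_cases hab : a = b
      · simp [hz, hw, ho, coords, horoPoint, symMat, hab, Matrix.one_apply]
        ring
      · simp [hz, hw, ho, coords, horoPoint, symMat, hab, Matrix.one_apply]
  have hzero : ∀ s : ℝ, extend f (z + (s : ℂ) • w) = 0 := by
    intro s
    obtain ⟨x, hx⟩ := hreal s
    rw [hx, extend_coords, h]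
  have hI : z + Complex.I • w = coords Z := by
    funext p
    simp only [hz, hw, Pi.add_apply, Pi.smul_apply, Pi.sub_apply, smul_eq_mul]
    linear_combination Complex.re_add_im (coords Z p)
  have hmem0 : (0 : ℂ) ∈ lineDomain z w := by
    obtain ⟨x, hx⟩ := hreal 0
    change z + (0 : ℂ) • w ∈ coordDomain n
    rw [Complex.ofReal_zero] at hx
    rw [hx]
    exact coords_mem _
  have hmemI : Complex.I ∈ lineDomain z w := by
    change z + Complex.I • w ∈ coordDomain n
    rw [hI]
    exact coords_mem _
  -- The zeros at `s = 1 / (k + 1)` accumulate at 0.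
  have hfreq : ∃ᶠ s in 𝓝[≠] (0 : ℂ), extend f (z + s • w) = 0 := by
    have ht : Filter.Tendsto (fun k : ℕ => (((1 / ((k : ℝ) + 1) : ℝ)) : ℂ)) Filter.atTop
        (𝓝[≠] 0) := by
      rw [tendsto_nhdsWithin_iff]
      refine ⟨?_, Filter.Eventually.of_forall fun k => ?_⟩
      · exact (Complex.continuous_ofReal.tendsto 0).comp tendsto_one_div_add_atTop_nhds_zero_nat
      · simp only [Set.mem_compl_iff, Set.mem_singleton_iff, Complex.ofReal_eq_zero]
        positivity
    exact ht.frequently (Filter.Frequently.of_forall fun k => hzero _)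
  have := ((hf.differentiableOn z w).analyticOnNhd
    (isOpen_lineDomain z w)).eqOn_zero_of_preconnected_of_frequently_eq_zero
    (isPreconnected_lineDomain z w) hmem0 hfreq hmemI
  simp only [hI, extend_coords] at this
  exact this

end Coordinates

/-! ### Fourier coefficients and the sieve operators -/

section Sieve

variable {n : ℕ} {V : Type*} [NormedAddCommGroup V] [NormedSpace ℂ V]

/-- The Fourier coefficients on the horosphere, indexed by integers. -/
def coefficient (f : upperHalfSpace n → V) (k : Sym2 (Fin n) → ℤ) : V :=
  cubeCoeff (fun x => f (horoPoint x)) k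

/-- Invariance under integral symmetric translations. -/
def IsIntInvariant (f : upperHalfSpace n → V) : Prop :=
  ∀ a : Sym2 (Fin n) → ℤ, translate (fun p => (a p : ℝ)) f = f

omit [NormedAddCommGroup V] [NormedSpace ℂ V] in
theorem translate_comm (x y : Sym2 (Fin n) → ℝ) (f : upperHalfSpace n → V) :
    translate x (translate y f) = translate y (translate x f) := by
  rw [translate_translate, translate_translate, add_comm]

omit [NormedAddCommGroup V] [NormedSpace ℂ V] in
theorem translate_horoPoint (x y : Sym2 (Fin n) → ℝ) (f : upperHalfSpace n → V) :
    translate y f (horoPoint x) = f (horoPoint (x + y)) := by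
  rw [horoPoint_add]
  rfl

omit [NormedAddCommGroup V] [NormedSpace ℂ V] in
theorem IsIntInvariant.isIntPeriodic {f : upperHalfSpace n → V} (hf : IsIntInvariant f) :
    IsIntPeriodic fun x => f (horoPoint x) := by
  intro a x
  simp only [← translate_horoPoint, hf a]

omit [NormedAddCommGroup V] [NormedSpace ℂ V] in
theorem IsIntInvariant.translate {f : upperHalfSpace n → V} (hf : IsIntInvariant f)
    (x : Sym2 (Fin n) → ℝ) : IsIntInvariant (translate x f) := fun a => by
  rw [translate_comm, hf a]

theorem coefficient_translate {f : upperHalfSpace n → V} (hf : IsIntInvariant f)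
    (y : Sym2 (Fin n) → ℝ) (k : Sym2 (Fin n) → ℤ) :
    coefficient (translate y f) k = character k y • coefficient f k := by
  simp only [coefficient, translate_horoPoint]
  exact cubeCoeff_translate hf.isIntPeriodic y k

theorem coefficient_fourierJacobi [CompleteSpace V] {f : upperHalfSpace n → V}
    (hf : IsIntInvariant f) (hc : Continuous f) (j : Fin n) (m : ℤ) (k : Sym2 (Fin n) → ℤ) :
    coefficient (fourierJacobi j m f) k = if k s(j, j) = m then coefficient f k else 0 := by
  simp only [coefficient, fourierJacobi, translate_horoPoint]
  exact cubeCoeff_integral_translate hf.isIntPeriodic (hc.comp continuous_horoPoint) _ m k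

theorem integrableOn_coefficient {f : upperHalfSpace n → V} (hf : Continuous f)
    (k : Sym2 (Fin n) → ℤ) :
    MeasureTheory.IntegrableOn (fun x => character (-k) x • f (horoPoint x))
      (unitCube (Sym2 (Fin n))) :=
  integrableOn_unitCube ((continuous_character _).smul (hf.comp continuous_horoPoint))

theorem coefficient_sub {f g : upperHalfSpace n → V} (hf : Continuous f) (hg : Continuous g)
    (k : Sym2 (Fin n) → ℤ) : coefficient (f - g) k = coefficient f k - coefficient g k := by
  simp only [coefficient, cubeCoeff, Pi.sub_apply, smul_sub]
  exact MeasureTheory.integral_sub (integrableOn_coefficient hf k) (integrableOn_coefficient hg k)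

theorem coefficient_smul (c : ℂ) (f : upperHalfSpace n → V) (k : Sym2 (Fin n) → ℤ) :
    coefficient (c • f) k = c • coefficient f k := by
  simp only [coefficient, cubeCoeff, Pi.smul_apply, smul_comm (character _ _) c]
  exact MeasureTheory.integral_smul _ _

theorem coefficient_sum {α : Type*} (s : Finset α) {f : α → upperHalfSpace n → V}
    (hf : ∀ a ∈ s, Continuous (f a)) (k : Sym2 (Fin n) → ℤ) :
    coefficient (∑ a ∈ s, f a) k = ∑ a ∈ s, coefficient (f a) k := by
  simp only [coefficient, cubeCoeff, Finset.sum_apply, Finset.smul_sum]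
  exact MeasureTheory.integral_finsetSum _ fun a ha => integrableOn_coefficient (hf a ha) k

/-- Uniqueness of the Fourier expansion. -/
theorem IsRegular.eq_zero_of_coefficient [CompleteSpace V] {f : upperHalfSpace n → V}
    (hf : IsRegular f) (hi : IsIntInvariant f) (h : ∀ k, coefficient f k = 0) : f = 0 :=
  hf.eq_zero_of_horoPoint fun x => congrFun (eq_zero_of_cubeCoeff_eq_zero hi.isIntPeriodic
    (hf.continuous.comp continuous_horoPoint) h) x

/-! ### Shifts by fractions and sieve projections. -/

/-- The translation of the `i`-th diagonal entry by `s`. -/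
def shift (i : Fin n) (s : ℝ) (f : upperHalfSpace n → V) : upperHalfSpace n → V :=
  translate (Pi.single s(i, i) s) f

omit [NormedAddCommGroup V] [NormedSpace ℂ V] in
theorem shift_shift (i : Fin n) (s t : ℝ) (f : upperHalfSpace n → V) :
    shift i s (shift i t f) = shift i (s + t) f := by
  rw [shift, shift, translate_translate, ← Pi.single_add]
  rfl

omit [NormedAddCommGroup V] [NormedSpace ℂ V] in
theorem IsIntInvariant.shift_int {f : upperHalfSpace n → V} (hf : IsIntInvariant f) (i : Fin n)
    (a : ℤ) : shift i a f = f := by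
  have := hf (Pi.single s(i, i) a)
  have e : (fun p => ((Pi.single s(i, i) a : Sym2 (Fin n) → ℤ) p : ℝ))
      = Pi.single s(i, i) (a : ℝ) := by
    funext p
    by_cases h : p = s(i, i)
    · subst h; simp
    · simp [h]
  rw [e] at this
  exact this

/-- The shift by `z / p` for a residue class `z` modulo `p`. -/
def classShift (i : Fin n) (p : ℕ) (z : ZMod p) (f : upperHalfSpace n → V) :
    upperHalfSpace n → V :=
  shift i ((z.val : ℝ) / p) f

-- Integral shifts act trivially, so a shift by `a / p` depends only on `a` modulo `p`.
omit [NormedAddCommGroup V] [NormedSpace ℂ V] in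
theorem classShift_intCast {f : upperHalfSpace n → V} (hf : IsIntInvariant f) (i : Fin n) (p : ℕ)
    [NeZero p] (a : ℤ) : classShift i p (a : ZMod p) f = shift i ((a : ℝ) / p) f := by
  have h1 : (((a : ZMod p).val : ℤ)) = a % p := ZMod.val_intCast a
  have h2 : ((a : ZMod p).val : ℝ) = a - p * (a / p : ℤ) := by
    have : (((a : ZMod p).val : ℤ)) = a - p * (a / p) := by rw [h1, Int.emod_def]
    exact_mod_cast congrArg (Int.cast : ℤ → ℝ) this
  have hp : (p : ℝ) ≠ 0 := Nat.cast_ne_zero.2 (NeZero.ne p)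
  have h3 : (a : ℝ) / p = ((a : ZMod p).val : ℝ) / p + (a / p : ℤ) := by
    rw [h2]
    field_simp
    ring
  rw [h3, ← shift_shift, hf.shift_int]
  rfl

/-- The projection to the part of the Fourier expansion with `T i i` divisible by `p`. -/
def average (i : Fin n) (p : ℕ) [NeZero p] (f : upperHalfSpace n → V) : upperHalfSpace n → V :=
  (p : ℂ)⁻¹ • ∑ z : ZMod p, classShift i p z f

/-- The projection to the part of the Fourier expansion with `T i i` not divisible by `p`. -/
def sieve (i : Fin n) (p : ℕ) [NeZero p] (f : upperHalfSpace n → V) : upperHalfSpace n → V :=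
  f - average i p f

theorem translate_smul (x : Sym2 (Fin n) → ℝ) (c : ℂ) (f : upperHalfSpace n → V) :
    translate x (c • f) = c • translate x f := rfl

omit [NormedSpace ℂ V] in
theorem translate_sum {α : Type*} (x : Sym2 (Fin n) → ℝ) (s : Finset α)
    (f : α → upperHalfSpace n → V) :
    translate x (∑ a ∈ s, f a) = ∑ a ∈ s, translate x (f a) := by
  funext Z
  simp [translate]

theorem translate_average (i : Fin n) (p : ℕ) [NeZero p] (x : Sym2 (Fin n) → ℝ)
    (f : upperHalfSpace n → V) :
    translate x (average i p f) = average i p (translate x f) := by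
  rw [average, translate_smul, translate_sum, average]
  simp only [classShift, shift, translate_comm x]

/-- A shift by `a / p` permutes the residue classes in the average. -/
theorem shift_average {f : upperHalfSpace n → V} (hf : IsIntInvariant f) (i : Fin n) (p : ℕ)
    [NeZero p] (a : ℤ) : shift i ((a : ℝ) / p) (average i p f) = average i p f := by
  rw [average, shift, translate_smul, translate_sum]
  congr 1
  refine Fintype.sum_equiv (Equiv.addLeft (a : ZMod p)) _ _ fun z => ?_
  have hz : ((z.val : ℤ) : ZMod p) = z := by simp
  have e : Equiv.addLeft (a : ZMod p) z = ((a + (z.val : ℤ) : ℤ) : ZMod p) := by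
    rw [Int.cast_add, hz]
    rfl
  rw [e, classShift_intCast hf]
  change shift i _ (shift i _ f) = _
  rw [shift_shift]
  congr 1
  push_cast
  ring

theorem IsIntInvariant.average {f : upperHalfSpace n → V} (hf : IsIntInvariant f) (i : Fin n)
    (p : ℕ) [NeZero p] : IsIntInvariant (average i p f) := fun a => by
  rw [translate_average, hf a]

omit [NormedSpace ℂ V] in
theorem IsIntInvariant.sub {f g : upperHalfSpace n → V} (hf : IsIntInvariant f)
    (hg : IsIntInvariant g) : IsIntInvariant (f - g) := fun a => by
  change Siegel.translate _ f - Siegel.translate _ g = _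
  rw [hf a, hg a]

theorem IsRegular.average {f : upperHalfSpace n → V} (hf : IsRegular f) (i : Fin n)
    (p : ℕ) [NeZero p] : IsRegular (average i p f) :=
  (isRegular_sum _ fun _ _ => hf.translate _).const_smul _

theorem exp_div_eq_one_iff {p : ℕ} (hp : p ≠ 0) (k : ℤ) :
    Complex.exp (2 * Real.pi * Complex.I * (k * ((1 : ℝ) / p : ℝ))) = 1 ↔ (p : ℤ) ∣ k := by
  rw [Complex.exp_eq_one_iff]
  have hp' : (p : ℂ) ≠ 0 := Nat.cast_ne_zero.2 hp
  constructor
  · rintro ⟨m, hm⟩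
    have h2 : (2 * Real.pi * Complex.I : ℂ) ≠ 0 := by simp [Real.pi_ne_zero]
    rw [mul_comm (m : ℂ)] at hm
    have h3 := mul_left_cancel₀ h2 hm
    refine ⟨m, ?_⟩
    push_cast at h3
    field_simp at h3
    exact_mod_cast h3
  · rintro ⟨m, rfl⟩
    refine ⟨m, ?_⟩
    push_cast
    field_simp

theorem coefficient_average {f : upperHalfSpace n → V} (hf : IsIntInvariant f) (hc : IsRegular f)
    (i : Fin n) (p : ℕ) [NeZero p] (k : Sym2 (Fin n) → ℤ) :
    coefficient (average i p f) k = if (p : ℤ) ∣ k s(i, i) then coefficient f k else 0 := by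
  split_ifs with h
  · obtain ⟨m, hm⟩ := h
    rw [average, coefficient_smul, coefficient_sum (f := fun z => classShift i p z f) _
      fun z _ => (hc.translate _).continuous]
    have : ∀ z : ZMod p, coefficient (classShift i p z f) k = coefficient f k := by
      intro z
      rw [classShift, shift, coefficient_translate hf, character_single]
      have hp : (p : ℂ) ≠ 0 := Nat.cast_ne_zero.2 (NeZero.ne p)
      rw [Complex.exp_eq_one_iff.2 ⟨m * z.val, ?_⟩, one_smul]
      rw [hm]
      push_cast
      field_simp
    simp only [this, Finset.sum_const, Finset.card_univ, ZMod.card]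
    rw [← Nat.cast_smul_eq_nsmul ℂ, smul_smul, inv_mul_cancel₀ (Nat.cast_ne_zero.2 (NeZero.ne p)),
      one_smul]
  · have h1 := shift_average hf i p 1
    have h2 := congrArg (fun g => coefficient g k) h1
    simp only [shift, coefficient_translate (hf.average i p), character_single] at h2
    nth_rw 2 [← one_smul ℂ (coefficient (average i p f) k)] at h2
    rw [← sub_eq_zero, ← sub_smul, smul_eq_zero, sub_eq_zero] at h2
    refine h2.resolve_left fun h3 => h ?_
    rw [Int.cast_one] at h3
    exact (exp_div_eq_one_iff (NeZero.ne p) _).1 h3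

/-- The regular functions with a Fourier expansion in which only `T` with `T i i > 0` occur. -/
structure IsCuspidalAt (i : Fin n) (f : upperHalfSpace n → V) : Prop where
  isRegular : IsRegular f
  isIntInvariant : IsIntInvariant f
  pos_of_coefficient_ne_zero : ∀ k, coefficient f k ≠ 0 → 0 < k s(i, i)

theorem coefficient_sieve {f : upperHalfSpace n → V} (hf : IsIntInvariant f) (hc : IsRegular f)
    (i : Fin n) (p : ℕ) [NeZero p] (k : Sym2 (Fin n) → ℤ) :
    coefficient (sieve i p f) k = if (p : ℤ) ∣ k s(i, i) then 0 else coefficient f k := by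
  rw [sieve, coefficient_sub hc.continuous (hc.average i p).continuous,
    coefficient_average hf hc]
  split_ifs <;> simp

theorem IsCuspidalAt.sieve {i : Fin n} {f : upperHalfSpace n → V} (hf : IsCuspidalAt i f) (p : ℕ)
    [NeZero p] : IsCuspidalAt i (sieve i p f) := by
  refine ⟨hf.1.sub (hf.1.average i p), hf.2.sub (hf.2.average i p), fun k hk => ?_⟩
  rw [coefficient_sieve hf.2 hf.1] at hk
  split_ifs at hk
  · exact absurd rfl hk
  · exact hf.3 k hk

end Sieve

/-! ### Equivariance under an embedded congruence subgroup of `SL₂(ℤ)` -/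

section Equivariance

variable {n : ℕ} {V : Type*} [NormedAddCommGroup V] [NormedSpace ℂ V]
  (ρ : Representation ℂ (GL (Fin n) ℂ) V)

/-- The slash operator of the embedded `SL₂(ℝ)`. -/
def slashSL2 (i : Fin n) (g : SpecialLinearGroup (Fin 2) ℝ) :
    (upperHalfSpace n → V) →ₗ[ℂ] (upperHalfSpace n → V) :=
  realSlash ρ (embedSL2 i g)

theorem slashSL2_mul (i : Fin n) (g h : SpecialLinearGroup (Fin 2) ℝ) (f : upperHalfSpace n → V) :
    slashSL2 ρ i (g * h) f = slashSL2 ρ i h (slashSL2 ρ i g f) := by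
  rw [slashSL2, map_mul, realSlash_mul]
  rfl

theorem slashSL2_upperSL2 (i : Fin n) (s : ℝ) (f : upperHalfSpace n → V) :
    slashSL2 ρ i (upperSL2 s) f = shift i s f := by
  rw [slashSL2, embedSL2_upperSL2, realSlash_translation_eq]
  rfl

theorem matrix_fin_two_congr {a b c d a' b' c' d' : ℝ} (ha : a = a') (hb : b = b') (hc : c = c')
    (hd : d = d') : !![a, b; c, d] = !![a', b'; c', d'] := by
  rw [ha, hb, hc, hd]

/-- The real matrix with integral entries `a`, `b`, `c`, `d`. -/
def intSL2 (a b c d : ℤ) (h : a * d - b * c = 1) : SpecialLinearGroup (Fin 2) ℝ :=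
  ⟨!![(a : ℝ), b; c, d], by rw [det_fin_two_of]; exact_mod_cast h⟩

variable {N : ℕ}

/-- Equivariance with character `χ` under the embedded group `Γ₀(K)`. -/
def IsEquivariantAt (χ : DirichletCharacter ℂ N) (i : Fin n) (K : ℕ)
    (f : upperHalfSpace n → V) : Prop :=
  ∀ (a b c d : ℤ) (h : a * d - b * c = 1), (K : ℤ) ∣ c →
    slashSL2 ρ i (intSL2 a b c d h) f = χ (d : ZMod N) • f

variable {ρ}

theorem intCast_eq_of_dvd_sub {K : ℕ} (hK : N ∣ K) {a b : ℤ} (h : (K : ℤ) ∣ a - b) :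
    (a : ZMod N) = b := by
  rw [← sub_eq_zero, ← Int.cast_sub, ZMod.intCast_zmod_eq_zero_iff_dvd]
  exact (Int.natCast_dvd_natCast.2 hK).trans h

/-- Moving `g` past the translation by `z / p` replaces it by an element of Γ₀(K) with the same `d`
modulo `N`, and `z` by `z d²`; since `d` is prime to `p`, this permutes the classes. -/
theorem IsEquivariantAt.average {χ : DirichletCharacter ℂ N} {i : Fin n} {K : ℕ}
    {f : upperHalfSpace n → V} (hf : IsEquivariantAt ρ χ i K f) (hi : IsIntInvariant f)
    (hK : N ∣ K) (p : ℕ) [Fact p.Prime] :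
    IsEquivariantAt ρ χ i (K * p ^ 2) (average i p f) := by
  intro a b c d h hc
  obtain ⟨e, rfl⟩ := hc
  have hp : (p : ℝ) ≠ 0 := Nat.cast_ne_zero.2 (NeZero.ne p)
  have hdet := congrArg (Int.cast : ℤ → ZMod p) h
  push_cast at hdet
  simp only [CharP.cast_eq_zero, ne_eq, OfNat.ofNat_ne_zero, not_false_eq_true, zero_pow,
    mul_zero, zero_mul, sub_zero] at hdet
  have hd : (d : ZMod p) ≠ 0 := right_ne_zero_of_mul_eq_one hdet
  have key : ∀ z : ℤ, slashSL2 ρ i (intSL2 a b _ d h) (shift i ((z : ℝ) / p) f)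
      = χ (d : ZMod N) • shift i (((z * d ^ 2 : ℤ) : ℝ) / p) f := by
    intro z
    -- The entries of `t(z/p) g t(-z d²/p)`, where `t` denotes translation. The factor `p²` in `c`
    -- clears the denominators, with `1 - a d = - b c` used for the upper right entry.
    have hg : (a + z * p * (K * e)) * (d - z * d ^ 2 * p * (K * e))
        - (b - z * d * b * p * (K * e) - z ^ 2 * d ^ 2 * (K * e)) * ((K * p ^ 2 : ℕ) * e) = 1 := by
      have h' := h
      push_cast at h' ⊢
      linear_combination (1 - z * d * p * K * e) * h'
    have hmul : upperSL2 ((z : ℝ) / p) * intSL2 a b _ d h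
        = intSL2 _ _ _ _ hg * upperSL2 (((z * d ^ 2 : ℤ) : ℝ) / p) := by
      have hR : (a : ℝ) * d - b * (((K * p ^ 2 : ℕ) : ℝ) * e) = 1 := by exact_mod_cast h
      push_cast at hR
      refine Subtype.ext ?_
      change !![(1 : ℝ), _; 0, 1] * !![(_ : ℝ), _; _, _] = !![(_ : ℝ), _; _, _] * !![(1 : ℝ), _; 0, 1]
      rw [mul_fin_two, mul_fin_two]
      push_cast
      refine matrix_fin_two_congr ?_ ?_ ?_ ?_
      · field_simp
        ring
      · field_simp
        linear_combination (- z * d) * hR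
      · ring
      · field_simp
        ring
    rw [← slashSL2_upperSL2 ρ, ← slashSL2_mul, hmul, slashSL2_mul,
      hf _ _ _ _ hg (Dvd.dvd.mul_right (by push_cast; exact dvd_mul_right _ _) _), map_smul,
      slashSL2_upperSL2]
    congr 2
    refine intCast_eq_of_dvd_sub hK ⟨- (z * d ^ 2 * p * e), by ring⟩
  rw [Siegel.average, map_smul, map_sum, smul_comm]
  congr 1
  rw [Finset.smul_sum]
  refine Fintype.sum_equiv (Equiv.mulRight₀ ((d : ZMod p) ^ 2) (pow_ne_zero 2 hd)) _ _ fun z => ?_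
  have hz : ((z.val : ℤ) : ZMod p) = z := by simp
  have e2 : Equiv.mulRight₀ ((d : ZMod p) ^ 2) (pow_ne_zero 2 hd) z
      = (((z.val : ℤ) * d ^ 2 : ℤ) : ZMod p) := by
    rw [Int.cast_mul, hz, Int.cast_pow]
    rfl
  rw [e2, classShift_intCast hi, ← key, ← classShift_intCast hi, hz]

theorem IsEquivariantAt.mono {χ : DirichletCharacter ℂ N} {i : Fin n} {K L : ℕ}
    {f : upperHalfSpace n → V} (hf : IsEquivariantAt ρ χ i K f) (h : K ∣ L) :
    IsEquivariantAt ρ χ i L f := fun a b c d hd hc =>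
  hf a b c d hd ((Int.natCast_dvd_natCast.2 h).trans hc)

theorem IsEquivariantAt.sieve {χ : DirichletCharacter ℂ N} {i : Fin n} {K : ℕ}
    {f : upperHalfSpace n → V} (hf : IsEquivariantAt ρ χ i K f) (hi : IsIntInvariant f)
    (hK : N ∣ K) (p : ℕ) [Fact p.Prime] :
    IsEquivariantAt ρ χ i (K * p ^ 2) (sieve i p f) := by
  intro a b c d h hc
  rw [Siegel.sieve, map_sub, hf.average hi hK p a b c d h hc,
    hf.mono (dvd_mul_right K (p ^ 2)) a b c d h hc, smul_sub]

/-! ### Consequences of invariance under the translation by `1 / p`. -/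

/-- A nonzero function that is equivariant under `Γ₀(N M)` and invariant under the translations by
`1 / p`, where `p ∣ N` and `p ∤ M`, has a character that factors through `N / p`. -/
theorem IsEquivariantAt.factorsThrough {χ : DirichletCharacter ℂ N} [NeZero N] {i : Fin n}
    {M p L : ℕ}
    {f : upperHalfSpace n → V} (hf : IsEquivariantAt ρ χ i (N * M) f) (hp : p.Prime)
    (hpM : ¬ p ∣ M) (hN : N = p * L) (hs : ∀ a : ℤ, shift i ((a : ℝ) / p) f = f) (h0 : f ≠ 0) :
    χ.FactorsThrough L := by
  have hLN : L ∣ N := ⟨p, by rw [hN, mul_comm]⟩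
  rw [DirichletCharacter.factorsThrough_iff_ker_unitsMap hLN]
  intro u hu
  rw [MonoidHom.mem_ker] at hu ⊢
  set U : ℤ := ((u : ZMod N).val : ℤ) with hU
  have hUu : (U : ZMod N) = u := by simp [hU]
  have hUL : (U : ZMod L) = 1 := by
    have h1 := congrArg Units.val hu
    rw [ZMod.unitsMap_val, Units.val_one] at h1
    rw [← h1, ← hUu, ZMod.cast_intCast hLN]
  obtain ⟨k, hk⟩ : (L : ℤ) ∣ U - 1 := by
    rw [← ZMod.intCast_zmod_eq_zero_iff_dvd]
    push_cast
    rw [hUL, sub_self]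
  have hUp : IsCoprime U (p : ℤ) := by
    have h1 : Nat.Coprime (u : ZMod N).val N := ZMod.val_coe_unit_coprime u
    rw [hU, Nat.isCoprime_iff_coprime]
    exact h1.coprime_dvd_right ⟨L, hN⟩
  have hMp : IsCoprime (M : ℤ) (p : ℤ) := by
    rw [Nat.isCoprime_iff_coprime]
    exact ((Nat.Prime.coprime_iff_not_dvd hp).2 hpM).symm
  -- With `r U M + s p = 1` and `e = -k r`, the upper right entry `(1 - U (1 + L M e)) / p` is the
  -- integer `-L k s`, and the lower right one is `U - N k s`, congruent to `U` modulo `N`.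
  obtain ⟨r, s, hrs⟩ := hUp.mul_left hMp
  have hNL : (N : ℤ) = p * L := by exact_mod_cast hN
  -- the integral matrix `t(1/p) ℓ(c) t(-U/p)` with `c = N M e`, `e = - k r`
  have hg : (1 + L * M * (-k * r)) * (U - N * (k * s)) - (-(L * (k * s))) * ((N * M : ℕ) * (-k * r))
      = 1 := by
    push_cast
    rw [hNL]
    linear_combination hk - (L : ℤ) * k * hrs
  have hl : (1 : ℤ) * 1 - 0 * ((N * M : ℕ) * (-k * r)) = 1 := by ring
  have hmul : upperSL2 (((1 : ℤ) : ℝ) / (p : ℝ)) * intSL2 1 0 _ 1 hl * upperSL2 (((-U : ℤ) : ℝ) / p)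
      = intSL2 _ _ _ _ hg := by
    have hpR : (p : ℝ) ≠ 0 := Nat.cast_ne_zero.2 hp.ne_zero
    have hNR : (N : ℝ) = p * L := by exact_mod_cast hN
    have hkR : (U : ℝ) - 1 = L * k := by exact_mod_cast hk
    have hrsR : (r : ℝ) * (U * M) + s * p = 1 := by exact_mod_cast hrs
    refine Subtype.ext ?_
    change !![(1 : ℝ), _; 0, 1] * !![(_ : ℝ), _; _, _] * !![(1 : ℝ), _; 0, 1] = !![(_ : ℝ), _; _, _]
    rw [mul_fin_two, mul_fin_two]
    push_cast
    rw [hNR]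
    refine matrix_fin_two_congr ?_ ?_ ?_ ?_
    · field_simp
      ring
    · field_simp
      linear_combination -hkR + (L : ℝ) * k * hrsR
    · ring
    · field_simp
      linear_combination (-p : ℝ) * hkR + (L : ℝ) * k * p * hrsR
  have h1 : f = χ (((U - N * (k * s) : ℤ)) : ZMod N) • f := by
    rw [← hf _ _ _ _ hg (dvd_mul_right _ _), ← hmul, slashSL2_mul, slashSL2_mul,
      slashSL2_upperSL2 ρ i (((1 : ℤ) : ℝ) / p), hs, hf _ _ _ _ hl (dvd_mul_right _ _),
      slashSL2_upperSL2]
    rw [Int.cast_one, map_one, one_smul, hs]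
  have h2 : (((U - N * (k * s) : ℤ)) : ZMod N) = u := by
    rw [← hUu]
    simp
  rw [h2] at h1
  have h3 : (1 - χ (u : ZMod N)) • f = 0 := by
    rw [sub_smul, one_smul, ← h1, sub_self]
  have h4 := (smul_eq_zero.1 h3).resolve_right h0
  apply Units.ext
  rw [MulChar.coe_toUnitHom, Units.val_one]
  exact (sub_eq_zero.1 h4).symm

/-- A function that is equivariant under `Γ₀(K)` and invariant under the translation by `1 / p`,
where `p ∤ K`, is invariant under the translations by `1 / p ^ (2 r)`. -/
theorem IsEquivariantAt.shift_eq {χ : DirichletCharacter ℂ N} {i : Fin n} {K p : ℕ}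
    {f : upperHalfSpace n → V} (hf : IsEquivariantAt ρ χ i K f) (hi : IsIntInvariant f)
    (hK : N ∣ K) (hp : p.Prime) (hpK : ¬ p ∣ K) (hs : shift i (1 / (p : ℝ)) f = f) (r : ℕ) :
    shift i (1 / ((p ^ 2 : ℕ) : ℝ) ^ r) f = f := by
  have hpR : (p : ℝ) ≠ 0 := Nat.cast_ne_zero.2 hp.ne_zero
  have hc : IsCoprime (p : ℤ) (K : ℤ) := by
    rw [Nat.isCoprime_iff_coprime]
    exact (Nat.Prime.coprime_iff_not_dvd hp).2 hpK
  obtain ⟨x, y, hxy⟩ := hc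
  -- The matrix with rows `(p, -1)`, `(K y, x)`: translating by `1 / p` on the right kills its upper
  -- right entry, and a lower unipotent element of Γ₀(K) then kills the lower left one.
  have hg : (p : ℤ) * x - (-1) * (K * y) = 1 := by linear_combination hxy
  have hl : (1 : ℤ) * 1 - 0 * (K * (- p * y)) = 1 := by ring
  set δ : SpecialLinearGroup (Fin 2) ℝ :=
    ⟨!![(p : ℝ), 0; 0, (p : ℝ)⁻¹], by rw [det_fin_two_of, mul_inv_cancel₀ hpR]; ring⟩ with hδ
  have hmul : intSL2 _ _ _ _ hg * upperSL2 (1 / (p : ℝ)) * intSL2 _ _ _ _ hl = δ := by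
    have hxyR : (x : ℝ) * p + y * K = 1 := by exact_mod_cast hxy
    refine Subtype.ext ?_
    change !![(_ : ℝ), _; _, _] * !![(1 : ℝ), _; 0, 1] * !![(_ : ℝ), _; _, _] = !![(_ : ℝ), _; _, _]
    rw [mul_fin_two, mul_fin_two]
    push_cast
    refine matrix_fin_two_congr ?_ ?_ ?_ ?_
    · field_simp
      ring
    · field_simp
      ring
    · field_simp
      linear_combination (-(K * y) : ℝ) * hxyR
    · field_simp
      linear_combination hxyR
  have hη : IsUnit (χ (x : ZMod N)) := by
    refine IsUnit.map χ (IsUnit.of_mul_eq_one (p : ZMod N) ?_)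
    have h1 : ((x * p : ℤ) : ZMod N) = (1 : ℤ) :=
      intCast_eq_of_dvd_sub hK ⟨-y, by linear_combination hxy⟩
    push_cast at h1
    exact h1
  have hδf : slashSL2 ρ i δ f = χ (x : ZMod N) • f := by
    rw [← hmul, slashSL2_mul, slashSL2_mul, hf _ _ _ _ hg (dvd_mul_right _ _), map_smul,
      slashSL2_upperSL2, hs, map_smul, hf _ _ _ _ hl (dvd_mul_right _ _)]
    simp
  -- The matrix `δ` carries translation by `s` to translation by `s / p²`, and fixes `f` up to the
  -- nonzero scalar `χ x`. The induction can thus start from the integral translation by 1.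
  have hstep : ∀ s : ℝ, shift i s f = f → shift i (s / ((p ^ 2 : ℕ) : ℝ)) f = f := by
    intro s h
    have hcomm : upperSL2 s * δ = δ * upperSL2 (s / ((p ^ 2 : ℕ) : ℝ)) := by
      refine Subtype.ext ?_
      change !![(1 : ℝ), _; 0, 1] * !![(_ : ℝ), _; _, _] = !![(_ : ℝ), _; _, _] * !![(1 : ℝ), _; 0, 1]
      rw [mul_fin_two, mul_fin_two]
      push_cast
      refine matrix_fin_two_congr ?_ ?_ ?_ ?_ <;> field_simp <;> ring
    have h1 := congrArg (fun g => slashSL2 ρ i g f) hcomm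
    simp only [slashSL2_mul, slashSL2_upperSL2, h, hδf] at h1
    exact (smul_right_injective _ hη.ne_zero h1).symm
  induction r with
  | zero => simpa using hi.shift_int i 1
  | succ r ih =>
    rw [pow_succ, ← div_div]
    exact hstep _ ih

/-- A nonzero coefficient would have a positive diagonal entry divisible by every power of `q`; the
exponent equal to the entry itself is already too large. -/
theorem IsCuspidalAt.eq_zero_of_shift [CompleteSpace V] {i : Fin n} {f : upperHalfSpace n → V}
    (hf : IsCuspidalAt i f) {q : ℕ} (hq : 1 < q)
    (hs : ∀ r : ℕ, shift i (1 / (q : ℝ) ^ r) f = f) : f = 0 := by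
  refine hf.isRegular.eq_zero_of_coefficient hf.isIntInvariant fun k => ?_
  by_contra hk
  have hpos := hf.pos_of_coefficient_ne_zero k hk
  set r := (k s(i, i)).toNat
  have h1 := congrArg (fun g => coefficient g k) (hs r)
  simp only [shift, coefficient_translate hf.isIntInvariant, character_single] at h1
  nth_rw 2 [← one_smul ℂ (coefficient f k)] at h1
  rw [← sub_eq_zero, ← sub_smul, smul_eq_zero, sub_eq_zero] at h1
  have h2 := h1.resolve_right hk
  have h3 := (exp_div_eq_one_iff (p := q ^ r) (by positivity) (k s(i, i))).1 (by
    rw [← h2]; push_cast; rfl)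
  have h4 := Int.le_of_dvd hpos h3
  have h5 : r < q ^ r := Nat.lt_pow_self hq
  have h6 : (r : ℤ) = k s(i, i) := Int.toNat_of_nonneg hpos.le
  rw [← h6] at h4
  exact absurd h4 (not_le.2 (by exact_mod_cast h5))

/-- A vanishing sieve means invariance under translations by `1 / p`. For `p ∣ N` this contradicts
the conductor; for `p ∤ N` the invariance spreads to arbitrarily small translations. -/
theorem IsCuspidalAt.eq_zero_of_sieve_eq_zero [CompleteSpace V] [NeZero N]
    {χ : DirichletCharacter ℂ N} (hχ : χ.conductor = N) {i : Fin n} {M p : ℕ} [Fact p.Prime]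
    {f : upperHalfSpace n → V} (hc : IsCuspidalAt i f) (hf : IsEquivariantAt ρ χ i (N * M) f)
    (hpM : ¬ p ∣ M) (h : Siegel.sieve i p f = 0) : f = 0 := by
  have hp : p.Prime := Fact.out
  have hs : ∀ a : ℤ, shift i ((a : ℝ) / p) f = f := by
    intro a
    have h1 : f = Siegel.average i p f := sub_eq_zero.1 h
    rw [h1]
    exact shift_average hc.isIntInvariant i p a
  by_cases hpN : p ∣ N
  · obtain ⟨L, hL⟩ := hpN
    by_contra h0
    have h1 : χ.conductor ≤ L :=
      Nat.sInf_le (hf.factorsThrough hp hpM hL hs h0)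
    have hLpos : 0 < L := Nat.pos_of_ne_zero fun h0 => NeZero.ne N (by rw [hL, h0, mul_zero])
    rw [hχ, hL] at h1
    nlinarith [hp.two_le]
  · refine hc.eq_zero_of_shift (q := p ^ 2) (Nat.one_lt_pow two_ne_zero hp.one_lt)
      (hf.shift_eq hc.isIntInvariant (dvd_mul_right N M) hp ?_ (by simpa using hs 1))
    rw [hp.dvd_mul]
    tauto

/-- The sieve: a cuspidal equivariant function with character of conductor `N` vanishes as soon as
its Fourier coefficients at all `T` with `T i i` prime to a given integer vanish. -/
theorem IsCuspidalAt.eq_zero_of_coprime [CompleteSpace V] [NeZero N]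
    {χ : DirichletCharacter ℂ N} (hχ : χ.conductor = N) {i : Fin n} (Q : Finset ℕ)
    (hQ : ∀ p ∈ Q, p.Prime) :
    ∀ (M : ℕ) (f : upperHalfSpace n → V), (∀ p ∈ Q, ¬ p ∣ M) → IsCuspidalAt i f →
      IsEquivariantAt ρ χ i (N * M) f →
      (∀ k, (∀ p ∈ Q, ¬ (p : ℤ) ∣ k s(i, i)) → coefficient f k = 0) → f = 0 := by
  induction Q using Finset.induction_on with
  | empty =>
    intro M f _ hc _ h
    exact hc.isRegular.eq_zero_of_coefficient hc.isIntInvariant fun k => h k (by simp)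
  | insert p Q hpQ ih =>
    intro M f hM hc hf h
    have hp : p.Prime := hQ p (Finset.mem_insert_self p Q)
    have : Fact p.Prime := ⟨hp⟩
    -- It suffices to kill the `p`-sieve of `f`. It has level `N M p²`, and `p` is not among the
    -- remaining primes, so the induction hypothesis applies to it.
    refine hc.eq_zero_of_sieve_eq_zero hχ hf (hM p (Finset.mem_insert_self p Q)) ?_
    refine ih (fun q hq => hQ q (Finset.mem_insert_of_mem hq)) (M * p ^ 2) (Siegel.sieve i p f) ?_
      (hc.sieve p) ?_ ?_
    · intro q hq hd
      have hqp : q.Prime := hQ q (Finset.mem_insert_of_mem hq)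
      rcases hqp.dvd_mul.1 hd with h1 | h1
      · exact hM q (Finset.mem_insert_of_mem hq) h1
      · have := (Nat.prime_dvd_prime_iff_eq hqp hp).1 (hqp.dvd_of_dvd_pow h1)
        exact hpQ (this ▸ hq)
    · rw [← mul_assoc]
      exact hf.sieve hc.isIntInvariant (dvd_mul_right N M) p
    · intro k hk
      rw [coefficient_sieve hc.isIntInvariant hc.isRegular]
      split_ifs with h1
      · rfl
      · refine h k fun q hq => ?_
        rcases Finset.mem_insert.1 hq with rfl | hq
        · exact h1
        · exact hk q hq

end Equivariance

/-! ### Half-integral matrices and integral coordinates -/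

section HalfIntegral

variable {n : ℕ} {V : Type*} [NormedAddCommGroup V] [NormedSpace ℂ V]

/-- The half-integral matrix with given integral coordinates. -/
def halfIntegralMat (k : Sym2 (Fin n) → ℤ) : Matrix (Fin n) (Fin n) ℝ :=
  Matrix.of fun a b => if a = b then (k s(a, b) : ℝ) else k s(a, b) / 2

theorem halfIntegralMat_diag (k : Sym2 (Fin n) → ℤ) (i : Fin n) :
    halfIntegralMat k i i = k s(i, i) := by
  simp [halfIntegralMat]

theorem isHalfIntegral_halfIntegralMat (k : Sym2 (Fin n) → ℤ) :
    IsHalfIntegral (halfIntegralMat k) := by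
  refine ⟨?_, fun i => ⟨k s(i, i), halfIntegralMat_diag k i⟩, fun i j => ?_⟩
  · ext i j
    simp [halfIntegralMat, Sym2.eq_swap, eq_comm]
  · by_cases h : i = j
    · exact ⟨2 * k s(i, j), by simp [halfIntegralMat, h]⟩
    · refine ⟨k s(i, j), ?_⟩
      simp only [halfIntegralMat, of_apply, if_neg h]
      ring

/-- The ordered pairs are grouped by unordered pair: an off-diagonal pair occurs twice, which
cancels the factor 1/2. -/
theorem trace_halfIntegralMat_mul_symMat (k : Sym2 (Fin n) → ℤ) (x : Sym2 (Fin n) → ℝ) :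
    ((halfIntegralMat k).map ((↑) : ℝ → ℂ) * (symMat x).map ((↑) : ℝ → ℂ)).trace
      = ∑ p, (k p : ℂ) * x p := by
  have e : ((halfIntegralMat k).map ((↑) : ℝ → ℂ) * (symMat x).map ((↑) : ℝ → ℂ)).trace
      = ∑ q : Fin n × Fin n, ((halfIntegralMat k q.1 q.2 : ℝ) : ℂ) * x s(q.1, q.2) := by
    rw [Fintype.sum_prod_type]
    simp [trace, Matrix.mul_apply, symMat, Sym2.eq_swap]
  rw [e, ← Finset.sum_fiberwise Finset.univ (fun q : Fin n × Fin n => s(q.1, q.2))]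
  refine Finset.sum_congr rfl fun p _ => ?_
  induction p with
  | _ a b =>
    by_cases h : a = b
    · subst h
      have hs : Finset.univ.filter (fun q : Fin n × Fin n => s(q.1, q.2) = s(a, a)) = {(a, a)} := by
        ext ⟨c, d⟩
        simp
      rw [hs, Finset.sum_singleton, halfIntegralMat_diag]
      simp
    · have hs : Finset.univ.filter (fun q : Fin n × Fin n => s(q.1, q.2) = s(a, b))
          = {(a, b), (b, a)} := by
        ext ⟨c, d⟩
        simp
      have hne : (a, b) ≠ (b, a) := fun hc => h (congrArg Prod.fst hc)
      rw [hs, Finset.sum_pair hne]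
      simp only [halfIntegralMat, of_apply, if_neg h, if_neg (Ne.symm h), Sym2.eq_swap (a := b)]
      push_cast
      ring

theorem qPow_horoPoint (k : Sym2 (Fin n) → ℤ) (x : Sym2 (Fin n) → ℝ) :
    (qPow (halfIntegralMat k) (horoPoint x).1)⁻¹
      = (qPow (halfIntegralMat k) (Complex.I • 1))⁻¹ * character (-k) x := by
  have h : qPow (halfIntegralMat k) (horoPoint x).1
      = qPow (halfIntegralMat k) (Complex.I • 1) * character k x := by
    change qPow _ ((symMat x).map _ + _) = _
    rw [qPow, Matrix.mul_add, trace_add, trace_halfIntegralMat_mul_symMat, add_comm, mul_add,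
      Complex.exp_add]
    rfl
  rw [h, mul_inv]
  congr 1
  exact (eq_inv_of_mul_eq_one_left (character_neg_mul k x)).symm

theorem fourierCoefficient_halfIntegralMat (f : upperHalfSpace n → V) (k : Sym2 (Fin n) → ℤ) :
    fourierCoefficient f (halfIntegralMat k)
      = (qPow (halfIntegralMat k) (Complex.I • 1))⁻¹ • coefficient f k := by
  rw [fourierCoefficient, coefficient, cubeCoeff, ← MeasureTheory.integral_smul]
  simp only [qPow_horoPoint, smul_smul]
  rfl

/-- The two normalisations differ by the nonzero value of `q^T` at the point `i`. -/
theorem fourierCoefficient_halfIntegralMat_eq_zero (f : upperHalfSpace n → V)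
    (k : Sym2 (Fin n) → ℤ) :
    fourierCoefficient f (halfIntegralMat k) = 0 ↔ coefficient f k = 0 := by
  rw [fourierCoefficient_halfIntegralMat, smul_eq_zero, or_iff_right]
  exact inv_ne_zero (Complex.exp_ne_zero _)

/-- A half-integral matrix is primitive if it has two coprime diagonal entries. -/
theorem isPrimitive_of_coprime_diag {T : Matrix (Fin n) (Fin n) ℝ} (hT : IsHalfIntegral T)
    {i j : Fin n} {a b : ℤ} (ha : T i i = a) (hb : T j j = b) (hab : IsCoprime a b) :
    IsPrimitive T := by
  have hdvd : ∀ {c : ℕ} (l : Fin n) {t : ℤ}, 0 < c → IsHalfIntegral ((c : ℝ)⁻¹ • T) →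
      T l l = t → (c : ℤ) ∣ t := by
    intro c l t hc h ht
    obtain ⟨d, hd⟩ := h.2.1 l
    have hc' : (c : ℝ) ≠ 0 := Nat.cast_ne_zero.2 hc.ne'
    rw [Matrix.smul_apply, ht, smul_eq_mul, inv_mul_eq_iff_eq_mul₀ hc'] at hd
    exact ⟨d, by exact_mod_cast hd⟩
  -- Any `c` in the set divides two coprime integers; thus the supremum is over a singleton and
  -- takes no default value.
  have hset : {c : ℕ | 0 < c ∧ IsHalfIntegral ((c : ℝ)⁻¹ • T)} = {1} := by
    ext c
    constructor
    · rintro ⟨hc, h⟩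
      have := hab.isUnit_of_dvd' (hdvd i hc h ha) (hdvd j hc h hb)
      exact Int.ofNat_isUnit.1 this |> Nat.isUnit_iff.1
    · rintro rfl
      exact ⟨one_pos, by simpa using hT⟩
  rw [IsPrimitive, content, hset, csSup_singleton]

end HalfIntegral

/-! ### Cusp forms -/

section CuspForm

variable {n N : ℕ} {V : Type*} [NormedAddCommGroup V] [NormedSpace ℂ V]
  {ρ : Representation ℂ (GL (Fin n) ℂ) V} {χ : DirichletCharacter ℂ N} {F : upperHalfSpace n → V}

/-- Integral translations lie in Γ₀(N) with `D = 1`, so the character contributes 1. -/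
theorem IsModularForm.isIntInvariant (hF : IsModularForm N ρ χ F) : IsIntInvariant F := by
  intro a
  let g : Sp n := ⟨fromBlocks 1 (symMat a) 0 1, SymplecticGroup.fromBlocks_mem_iff.2 <| by
    simp [(symMat_isSymm a).eq]⟩
  have hC : blockC g = 0 := toBlocks_fromBlocks₂₁ _ _ _ _
  have hD : blockD g = 1 := toBlocks_fromBlocks₂₂ _ _ _ _
  have hg : g ∈ Gamma0 n N := fun i j => by simp [hC]
  have h := hF.slash_eq g hg
  have e : toRealSp g = translation fun p => (a p : ℝ) := by
    apply Subtype.ext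
    change (fromBlocks _ _ _ _).map _ = fromBlocks _ _ _ _
    rw [fromBlocks_map]
    congr 1
    · exact Matrix.map_one _ (map_zero _) (map_one _)
    · exact Matrix.map_zero _ (map_zero _)
    · exact Matrix.map_one _ (map_zero _) (map_one _)
  rw [← realSlash_toRealSp, e, realSlash_translation_eq, hD] at h
  simpa using h

theorem IsModularForm.isEquivariantAt (hF : IsModularForm N ρ χ F) (i : Fin n) :
    IsEquivariantAt ρ χ i N F := by
  intro a b c d h hc
  let g : SpecialLinearGroup (Fin 2) ℤ := ⟨!![a, b; c, d], by rw [det_fin_two_of, h]⟩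
  have hg : embedSL2 i g ∈ Gamma0 n N := by
    intro k l
    rw [blockC_embedSL2, diagonal_apply, Pi.single_apply]
    split_ifs
    · exact hc
    · exact dvd_zero _
    · exact dvd_zero _
  have e : g.map (Int.castRingHom ℝ) = intSL2 a b c d h := by
    ext k l
    fin_cases k <;> fin_cases l <;> rfl
  have h1 := hF.slash_eq _ hg
  rw [← realSlash_toRealSp, toRealSp_embedSL2, e, blockD_embedSL2_det] at h1
  exact h1

theorem fourierJacobi_smul (j : Fin n) (m : ℤ) (c : ℂ) (f : upperHalfSpace n → V) :
    fourierJacobi j m (c • f) = c • fourierJacobi j m f := by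
  funext Z
  simp only [fourierJacobi, translate_smul, Pi.smul_apply, smul_comm _ c]
  exact intervalIntegral.integral_smul _ _

/-- The slash operator commutes with translations in the `j`-th diagonal entry. At a fixed point it
applies a linear map of a finite-dimensional space, which is continuous and passes through the
integral. -/
theorem slashSL2_fourierJacobi [FiniteDimensional ℂ V] (ρ : Representation ℂ (GL (Fin n) ℂ) V)
    {f : upperHalfSpace n → V} (hf : Continuous f) {i j : Fin n} (hij : i ≠ j) (m : ℤ)
    (g : SpecialLinearGroup (Fin 2) ℝ) :
    slashSL2 ρ i g (fourierJacobi j m f) = fourierJacobi j m (slashSL2 ρ i g f) := by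
  have : CompleteSpace V := FiniteDimensional.complete ℂ V
  have hcomm : ∀ t : ℝ, slashSL2 ρ i g (translate (Pi.single s(j, j) t) f)
      = translate (Pi.single s(j, j) t) (slashSL2 ρ i g f) := by
    intro t
    simp only [slashSL2, ← realSlash_translation_eq ρ, ← realSlash_mul,
      translation_mul_embedSL2 hij]
  funext Z
  set W := realAction (embedSL2 i g) Z with hW
  set l : V →L[ℂ] V := LinearMap.toContinuousLinearMap (ρ (realDenomGL (embedSL2 i g) Z)⁻¹) with hl
  have hc : Continuous fun t : ℝ => Complex.exp (2 * Real.pi * Complex.I * ((-m : ℤ) * t)) •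
      translate (Pi.single s(j, j) t) f W :=
    (continuous_fourierJacobi_integrand hf j m).comp (Continuous.prodMk_right W)
  change l (fourierJacobi j m f W) = _
  rw [fourierJacobi, ← l.intervalIntegral_comp_comm (hc.intervalIntegrable 0 1)]
  simp only [map_smul, fourierJacobi, ← hcomm]
  rfl

theorem IsIntInvariant.fourierJacobi {f : upperHalfSpace n → V} (hf : IsIntInvariant f)
    (j : Fin n) (m : ℤ) : IsIntInvariant (fourierJacobi j m f) := by
  intro a
  funext Z
  have h : ∀ x, Siegel.translate x f (realAction (translation fun p => (a p : ℝ)) Z)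
      = Siegel.translate x f Z := fun x => congrFun (hf.translate x a) Z
  simp only [Siegel.translate, Siegel.fourierJacobi] at h ⊢
  simp only [h]

theorem IsEquivariantAt.fourierJacobi [FiniteDimensional ℂ V] {f : upperHalfSpace n → V}
    {i j : Fin n} {K : ℕ} (hf : IsEquivariantAt ρ χ i K f) (hc : Continuous f) (hij : i ≠ j)
    (m : ℤ) : IsEquivariantAt ρ χ i K (fourierJacobi j m f) := by
  intro a b c d h hK
  rw [slashSL2_fourierJacobi ρ hc hij, hf a b c d h hK, fourierJacobi_smul]

theorem IsCuspForm.posDef_of_coefficient_ne_zero (hF : IsCuspForm N ρ χ F)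
    {k : Sym2 (Fin n) → ℤ} (hk : coefficient F k ≠ 0) : (halfIntegralMat k).PosDef :=
  hF.posDef_of_coeff_ne_zero _ (isHalfIntegral_halfIntegralMat k) fun h =>
    hk ((fourierCoefficient_halfIntegralMat_eq_zero F k).1 h)

theorem pos_of_posDef_halfIntegralMat {k : Sym2 (Fin n) → ℤ} (hk : (halfIntegralMat k).PosDef)
    (i : Fin n) : 0 < k s(i, i) := by
  have := hk.diag_pos (i := i)
  rw [halfIntegralMat_diag] at this
  exact_mod_cast this

theorem IsCuspForm.isCuspidalAt_fourierJacobi [CompleteSpace V] (hF : IsCuspForm N ρ χ F)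
    (i j : Fin n) (m : ℤ) : IsCuspidalAt i (fourierJacobi j m F) := by
  have hr := hF.holomorphic.isRegular
  have hi := hF.toIsModularForm.isIntInvariant
  refine ⟨hr.fourierJacobi j m, hi.fourierJacobi j m, fun k hk => ?_⟩
  rw [coefficient_fourierJacobi hi hr.continuous] at hk
  exact pos_of_posDef_halfIntegralMat
    (hF.posDef_of_coefficient_ne_zero (ite_ne_right_iff.1 hk).2) i

/-- Here `T j j = m`, so the terms with `T i i` prime to `m` are primitive and absent; the sieve at
the primes dividing `m` concludes. -/
theorem IsCuspForm.fourierJacobi_eq_zero [FiniteDimensional ℂ V] [NeZero N]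
    (hF : IsCuspForm N ρ χ F) (hχ : χ.conductor = N) {i j : Fin n} (hij : i ≠ j)
    (h : ∀ k, IsPrimitive (halfIntegralMat k) → coefficient F k = 0) {m : ℤ} (hm : 0 < m) :
    fourierJacobi j m F = 0 := by
  have : CompleteSpace V := FiniteDimensional.complete ℂ V
  have hr := hF.holomorphic.isRegular
  have hi := hF.toIsModularForm.isIntInvariant
  -- The sieve starts at level `N` itself, that is with `M = 1`. As `m ≠ 0`, its finite set of prime
  -- factors detects coprimality with `m`.
  refine (hF.isCuspidalAt_fourierJacobi i j m).eq_zero_of_coprime hχ m.natAbs.primeFactors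
    (fun p hp => Nat.prime_of_mem_primeFactors hp) 1 _
    (fun p hp => (Nat.prime_of_mem_primeFactors hp).one_lt.ne' ∘ Nat.dvd_one.1)
    (by
      rw [mul_one]
      exact (hF.toIsModularForm.isEquivariantAt i).fourierJacobi hr.continuous hij m)
    fun k hk => ?_
  rw [coefficient_fourierJacobi hi hr.continuous]
  split_ifs with hkm
  · refine h k (isPrimitive_of_coprime_diag (isHalfIntegral_halfIntegralMat k)
      (halfIntegralMat_diag k i) (halfIntegralMat_diag k j) ?_)
    rw [hkm, Int.isCoprime_iff_gcd_eq_one]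
    refine Nat.coprime_of_dvd fun p hp h1 h2 => ?_
    exact hk p (Nat.mem_primeFactors.2 ⟨hp, h2, by omega⟩) (Int.natCast_dvd.2 h1)
  · rfl

end CuspForm

end Siegel

end

theorem lemma5p1 {n : ℕ} (hn : 2 ≤ n) {N : ℕ} (hN : 0 < N)
    {V : Type*} [NormedAddCommGroup V] [NormedSpace ℂ V] [FiniteDimensional ℂ V]
    (ρ : Representation ℂ (Matrix.GeneralLinearGroup (Fin n) ℂ) V)
    (hρ : Siegel.IsPolynomialRep ρ)
    (χ : DirichletCharacter ℂ N) (hχ : χ.conductor = N)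
    (F : Siegel.upperHalfSpace n → V) (hF : Siegel.IsCuspForm N ρ χ F) (hF0 : F ≠ 0) :
    ∃ T ∈ Siegel.halfIntegralPos n, Siegel.IsPrimitive T ∧ Siegel.fourierCoefficient F T ≠ 0 := by
  by_contra! hcon
  have : NeZero N := ⟨hN.ne'⟩
  have : CompleteSpace V := FiniteDimensional.complete ℂ V
  have hr := hF.holomorphic.isRegular
  have hi := hF.toIsModularForm.isIntInvariant
  have hprim : ∀ k, Siegel.IsPrimitive (Siegel.halfIntegralMat k) → Siegel.coefficient F k = 0 := by
    intro k hk
    by_contra h0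
    exact h0 ((Siegel.fourierCoefficient_halfIntegralMat_eq_zero F k).1 (hcon _
      ⟨Siegel.isHalfIntegral_halfIntegralMat k, hF.posDef_of_coefficient_ne_zero h0⟩ hk))
  have hij : (⟨0, by omega⟩ : Fin n) ≠ ⟨1, by omega⟩ := by simp
  refine hF0 (hr.eq_zero_of_coefficient hi fun k => ?_)
  by_contra h0
  have hpos := Siegel.pos_of_posDef_halfIntegralMat (hF.posDef_of_coefficient_ne_zero h0)
    (⟨1, by omega⟩ : Fin n)
  -- The coefficient of `F` at `k` is also one of the Fourier-Jacobi coefficient of index `T j j >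
  -- 0`, which vanishes.
  have h1 := Siegel.coefficient_fourierJacobi hi hr.continuous ⟨1, by omega⟩
    (k s(⟨1, by omega⟩, ⟨1, by omega⟩)) k
  rw [hF.fourierJacobi_eq_zero hχ hij hprim hpos, if_pos rfl] at h1
  refine h0 (h1.symm.trans ?_)
  simp [Siegel.coefficient, Siegel.cubeCoeff]
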